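/- Let $G$ be a finite-dimensional real Lie group with Lie algebra $\mathfrak g$. Call $G$ *special* if $\mathfrak g$ is not abelian and, for all $x,y\in\mathfrak g$, the bracket $[x,y]$ is a linear combination of $x$ and $y$. The tangent bundle $TG$ is a Lie group with multiplication $T\mu$ and inversion $T\iota$, the tangent maps of the multiplication $\mu$ and the inversion $\iota$ of $G$. For a vector field $X$ on $G$, the vertical lift $X^v$ is the vector field on $TG$ whose value at $w\in T_hG$ is the velocity at $t=0$ of $t\mapsto w+tX(h)$, and the complete lift $X^c$ is the vector field on $TG$ whose value at $w$ is the velocity at $t=0$ of $t\mapsto T\phi_t(w)$, where $\phi_t$ is the (local) one-parameter group of $X$. Let $g$ be a left-invariant Riemannian metric on $G$, and let $\widetilde g$ be the left-invariant Riemannian metric on the Lie group $TG$ whose value at the identity $0\in T_eG$, where the tangent space is $T_eG\times T_eG$ (vectors tangent to the zero section, and vertical vectors), is $((a,b),(a',b'))\mapsto g_e(a,a')+g_e(b,b')$. Suppose that $G$ is special. Then: 1. for all left-invariant vector fields $X,Y$ on $G$, $\widetilde g(X^c,Y^c)=\widetilde g(X^v,Y^v)=g(X,Y)$ and $\widetilde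 g(X^c,Y^v)=0$ on $TG$, that is, $\widetilde g$ is the metric on $TG$ lifted from $g$; 2. $(G,g)$ has constant negative sectional curvature: there is $c>0$ such that every tangent plane at every point of $G$ has sectional curvature $-c$; 3. nevertheless $(TG,\widetilde g)$ has positive, negative and zero sectional curvatures: at every point of $TG$ there are a tangent plane of positive sectional curvature, one of negative sectional curvature and one of zero sectional curvature. -/

import Mathlib

open Bundle Filter Topology
open scoped Manifold ContDiff

noncomputable section

namespace TangentLie

variable {E : Type*} [NormedAddCommGroup E] [NormedSpace ℝ E]
  {H : Type*} [TopologicalSpace H] {I : ModelWithCorners ℝ E H}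
  {M : Type*} [TopologicalSpace M] [ChartedSpace H M]
  {G : Type*} [TopologicalSpace G] [ChartedSpace H G] [Group G]

/-! ### Levi-Civita connection, curvature tensor, sectional curvature -/

section Riemannian

variable [IsManifold I ∞ M]

/-- The curvature tensor `R(u, v) w = ∇_u ∇_v w - ∇_v ∇_u w - ∇_[u, v] w` at `x`, the tangent
vectors `u`, `v`, `w` being extended to vector fields that are smooth near `x`. -/
def curvature (D : CovariantDerivative I E (TangentSpace I : M → Type _)) (x : M)
    (u v w : TangentSpace I x) : TangentSpace I x :=
  let X : (y : M) → TangentSpace I y := FiberBundle.extend E u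
  let Y : (y : M) → TangentSpace I y := FiberBundle.extend E v
  let Z : (y : M) → TangentSpace I y := FiberBundle.extend E w
  D (fun y => D Z y (Y y)) x (X x) - D (fun y => D Z y (X y)) x (Y x) -
    D Z x (VectorField.mlieBracket I X Y x)

variable [FiniteDimensional ℝ E]

/-- `D` is a Levi-Civita connection of the Riemannian metric `g`: it is torsion-free and compatible
with `g`, i.e. `u (g (Y, Z)) = g (∇_u Y, Z) + g (Y, ∇_u Z)`. In Mathlib's convention
`D Y x u` is `∇_u Y` at `x`. -/
structure IsLeviCivita (g : ContMDiffRiemannianMetric I ∞ E (TangentSpace I : M → Type _))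
    (D : CovariantDerivative I E (TangentSpace I : M → Type _)) : Prop where
  torsion_eq_zero : D.torsion = 0
  metric_compatible : ∀ (Y Z : (x : M) → TangentSpace I x) (x : M) (u : TangentSpace I x),
    MDiffAt (T% Y) x → MDiffAt (T% Z) x →
      mvfderiv I (fun y => g.inner y (Y y) (Z y)) x u =
        g.inner x (D Y x u) (Z x) + g.inner x (Y x) (D Z x u)

open Classical in
/-- The sectional curvature
`K(u, v) = g (R(u, v) v, u) / (g (u, u) g (v, v) - g (u, v) ^ 2)` of the metric `g` at `x`, where
`R` is the curvature tensor of the Levi-Civita connection. (Two Levi-Civita connections agree on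
differentiable vector fields, hence have the same curvature tensor.) -/
def sectionalCurvature (g : ContMDiffRiemannianMetric I ∞ E (TangentSpace I : M → Type _))
    (x : M) (u v : TangentSpace I x) : ℝ :=
  if h : ∃ D : CovariantDerivative I E (TangentSpace I : M → Type _), IsLeviCivita g D then
    g.inner x (curvature h.choose x u v v) u /
      (g.inner x u u * g.inner x v v - g.inner x u v ^ 2)
  else 0

end Riemannian

/-! ### Vertical and complete lifts of vector fields -/

section Lifts

/-- `φ` is a local one-parameter group of diffeomorphisms generated by `X` near `x`: for `y` near
`x` the curve `t ↦ φ t y` starts at `y` and is an integral curve of `X` for `t` near `0`. -/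
def IsLocalFlow (X : (x : M) → TangentSpace I x) (φ : ℝ → M → M) (x : M) : Prop :=
  (∀ᶠ y in 𝓝 x, φ 0 y = y) ∧
    ∀ᶠ p : ℝ × M in 𝓝 ((0 : ℝ), x),
      HasMFDerivAt 𝓘(ℝ, ℝ) I (fun t => φ t p.2) p.1
        ((1 : ℝ →L[ℝ] ℝ).smulRight (X (φ p.1 p.2)))

variable [IsManifold I 1 M]

/-- The vertical lift `X^v`, a vector field on `TM`: its value at `w ∈ T_x M` is the velocity at
`t = 0` of `t ↦ w + t X(x)`. -/
def verticalLift (X : (x : M) → TangentSpace I x) (w : TangentBundle I M) :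
    TangentSpace I.tangent w :=
  show E × E from mfderiv 𝓘(ℝ, ℝ) I.tangent
    (fun t : ℝ => (⟨w.proj, w.2 + t • X w.proj⟩ : TangentBundle I M)) 0 (1 : ℝ)

open Classical in
/-- The complete lift `X^c`, a vector field on `TM`: its value at `w` is the velocity at `t = 0` of
`t ↦ T φ_t (w)`, where `φ_t` is the (local) one-parameter group of `X`. (The value does not depend
on the choice of `φ`, by uniqueness of integral curves.) -/
def completeLift (X : (x : M) → TangentSpace I x) (w : TangentBundle I M) :
    TangentSpace I.tangent w :=
  if h : ∃ φ : ℝ → M → M, IsLocalFlow X φ w.proj then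
    show E × E from mfderiv 𝓘(ℝ, ℝ) I.tangent
      (fun t : ℝ => tangentMap I I (h.choose t) w) 0 (1 : ℝ)
  else 0

end Lifts

/-! ### The tangent Lie group -/

section TangentGroup

/-- The multiplication `Tμ : TG × TG → TG` of the tangent bundle, the tangent map of the
multiplication `μ` of `G`. -/
def tangentMul (v w : TangentBundle I G) : TangentBundle I G :=
  tangentMap (I.prod I) I (fun p : G × G => p.1 * p.2)
    ((equivTangentBundleProd I G I G).symm (v, w))

/-- The inversion `Tι : TG → TG`, the tangent map of the inversion `ι` of `G`. -/
def tangentInv (v : TangentBundle I G) : TangentBundle I G :=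
  tangentMap I I (fun x : G => x⁻¹) v

theorem tangentBundle_ext {x y : M} (h : x = y) {u v : E} (h' : u = v) :
    (⟨x, u⟩ : TangentBundle I M) = ⟨y, v⟩ := by
  subst h; subst h'; rfl

variable [LieGroup I ∞ G]

theorem mdiff_left (a x : G) : MDifferentiableAt I I (fun y : G => a * y) x :=
  (contMDiff_mul_left (I := I) (n := ∞) (a := a)).mdifferentiable (by simp) x

theorem mdiff_right (a x : G) : MDifferentiableAt I I (fun y : G => y * a) x :=
  (contMDiff_mul_right (I := I) (n := ∞) (a := a)).mdifferentiable (by simp) x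

theorem mdiff_mul (p : G × G) :
    MDifferentiableAt (I.prod I) I (fun p : G × G => p.1 * p.2) p :=
  (contMDiff_mul I ∞).mdifferentiable (by simp) _

theorem mdiff_inv (x : G) : MDifferentiableAt I I (fun y : G => y⁻¹) x :=
  (contMDiff_inv I ∞).mdifferentiable (by simp) x

theorem tangentMul_eq (v w : TangentBundle I G) :
    tangentMul v w = ⟨v.1 * w.1,
      mfderiv I I (fun y : G => v.1 * y) w.1 w.2 + mfderiv I I (fun y : G => y * w.1) v.1 v.2⟩ := by
  have h : MDifferentiableAt (I.prod I) I (fun p : G × G => p.1 * p.2) (v.1, w.1) :=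
    mdiff_mul _
  unfold tangentMul
  simp only [tangentMap, equivTangentBundleProd]
  congr 1
  exact (mfderiv_prod_eq_add_apply h).trans (add_comm _ _)

theorem tangentMul_assoc (u v w : TangentBundle I G) :
    tangentMul (tangentMul u v) w = tangentMul u (tangentMul v w) := by
  obtain ⟨x, u⟩ := u
  obtain ⟨y, v⟩ := v
  obtain ⟨z, w⟩ := w
  simp only [tangentMul_eq]
  have c1 := mfderiv_comp (I' := I) z (mdiff_left (I := I) x (y * z)) (mdiff_left (I := I) y z)
  have c2 := mfderiv_comp (I' := I) x (mdiff_right (I := I) z (x * y)) (mdiff_right (I := I) y x)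
  have c3 := mfderiv_comp (I' := I) y (mdiff_right (I := I) z (x * y)) (mdiff_left (I := I) x y)
  have c4 := mfderiv_comp (I' := I) y (mdiff_left (I := I) x (y * z)) (mdiff_right (I := I) z y)
  have f1 : (fun t : G => x * t) ∘ (fun t : G => y * t) = fun t => x * y * t := by
    funext t; simp [mul_assoc]
  have f2 : (fun t : G => t * z) ∘ (fun t : G => t * y) = fun t => t * (y * z) := by
    funext t; simp [mul_assoc]
  have f3 : (fun t : G => t * z) ∘ (fun t : G => x * t)
      = (fun t : G => x * t) ∘ (fun t : G => t * z) := by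
    funext t; simp [mul_assoc]
  rw [f1] at c1
  rw [f2] at c2
  rw [f3] at c3
  refine tangentBundle_ext (mul_assoc x y z) ?_
  have d1 : mfderiv I I (fun t : G => x * y * t) z w =
    mfderiv I I (fun t : G => x * t) (y * z) (mfderiv I I (fun t : G => y * t) z w) :=
      DFunLike.congr_fun c1 w
  have d2 : mfderiv I I (fun t : G => t * (y * z)) x u =
    mfderiv I I (fun t : G => t * z) (x * y) (mfderiv I I (fun t : G => t * y) x u) :=
      DFunLike.congr_fun c2 u
  have d3 : (mfderiv I I (fun t : G => x * t) (y * z) (mfderiv I I (fun t : G => t * z) y v) : E) =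
    mfderiv I I (fun t : G => t * z) (x * y) (mfderiv I I (fun t : G => x * t) y v) :=
      (DFunLike.congr_fun c4 v).symm.trans (DFunLike.congr_fun c3 v)
  have a1 := map_add (mfderiv I I (fun t : G => t * z) (x * y))
    (mfderiv I I (fun t : G => x * t) y v) (mfderiv I I (fun t : G => t * y) x u)
  have a2 := map_add (mfderiv I I (fun t : G => x * t) (y * z))
    (mfderiv I I (fun t : G => y * t) z w) (mfderiv I I (fun t : G => t * z) y v)
  refine (congrArg₂ (· + ·) d1 a1 : _ = (_ : E)).trans ?_
  refine Eq.trans ?_ (congrArg₂ (· + ·) a2 d2 : _ = (_ : E)).symm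
  refine Eq.trans ?_ (congrArg (fun t : E => HAdd.hAdd (α := E) (β := E) (γ := E) (HAdd.hAdd (α := E) (β := E) (γ := E)
    (mfderiv I I (fun t : G => x * t) (y * z) (mfderiv I I (fun t : G => y * t) z w)) t)
    (mfderiv I I (fun t : G => t * z) (x * y) (mfderiv I I (fun t : G => t * y) x u))) d3).symm
  exact (add_assoc (G := E) _ _ _).symm

theorem tangentOne_mul (v : TangentBundle I G) :
    tangentMul (⟨1, (0 : E)⟩ : TangentBundle I G) v = v := by
  obtain ⟨x, v⟩ := v
  rw [tangentMul_eq]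
  refine tangentBundle_ext (one_mul x) ?_
  have f : (fun t : G => 1 * t) = id := by funext t; simp
  have c : mfderiv I I (fun t : G => 1 * t) x = ContinuousLinearMap.id ℝ E := by
    rw [f]; exact mfderiv_id
  have d : mfderiv I I (fun t : G => 1 * t) x v = v := DFunLike.congr_fun c v
  have a := map_zero (mfderiv I I (fun y : G => y * x) 1)
  exact (congrArg₂ (· + ·) d a : _ = (_ : E)).trans (add_zero (M := E) _)

theorem tangentInv_mul (v : TangentBundle I G) :
    tangentMul (tangentInv v) v = (⟨1, (0 : E)⟩ : TangentBundle I G) := by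
  obtain ⟨x, v⟩ := v
  have h : MDifferentiableAt I (I.prod I) (fun y : G => (y⁻¹, y)) x :=
    (mdiff_inv x).prodMk mdifferentiableAt_id
  have c := mfderiv_comp (I' := I.prod I) x (f := fun y : G => (y⁻¹, y)) (mdiff_mul (I := I) (x⁻¹, x)) h
  have f : (fun p : G × G => p.1 * p.2) ∘ (fun y : G => (y⁻¹, y)) = fun _ => 1 := by
    funext t; simp
  rw [f, mfderiv_const] at c
  have p := mfderiv_prodMk (mdiff_inv (I := I) x) (mdifferentiableAt_id (I := I) (x := x))
  unfold tangentMul tangentInv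
  refine tangentBundle_ext (inv_mul_cancel x) ?_
  have q : mfderiv I (I.prod I) (fun y : G => (y⁻¹, y)) x v =
      (mfderiv I I (fun y : G => y⁻¹) x v, v) := by
    refine (DFunLike.congr_fun p v).trans ?_
    exact Prod.ext rfl (DFunLike.congr_fun (mfderiv_id (I := I) (x := x)) v)
  have r : (0 : E) = mfderiv (I.prod I) I (fun p : G × G => p.1 * p.2) (x⁻¹, x)
    (mfderiv I (I.prod I) (fun y : G => (y⁻¹, y)) x v) := DFunLike.congr_fun c v
  rw [q] at r
  exact r.symm

/-- The tangent group `TG`: multiplication `Tμ`, inversion `Tι`, neutral element `0 ∈ T_e G`. -/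
instance tangentGroup : Group (TangentBundle I G) :=
  letI : Mul (TangentBundle I G) := ⟨tangentMul⟩
  letI : One (TangentBundle I G) := ⟨⟨1, (0 : E)⟩⟩
  letI : Inv (TangentBundle I G) := ⟨tangentInv⟩
  Group.ofLeftAxioms tangentMul_assoc tangentOne_mul tangentInv_mul

instance tangentLieGroup : LieGroup I.tangent ∞ (TangentBundle I G) where
  toIsManifold := inferInstance
  contMDiff_mul := by
    have h := ((contMDiff_mul I ∞ (G := G)).contMDiff_tangentMap (m := ∞) le_rfl).comp
      (contMDiff_equivTangentBundleProd_symm (I := I) (I' := I) (M := G) (M' := G) (n := ∞))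
    exact h
  contMDiff_inv := (contMDiff_inv I ∞ (G := G)).contMDiff_tangentMap (m := ∞) le_rfl

end TangentGroup

/-! ### Left-invariant Riemannian metrics -/

section Metric

/-- The metric `g` on the Lie group `G` is left-invariant: all left translations are isometries. -/
def IsLeftInvariant [IsManifold I 1 G]
    (g : ContMDiffRiemannianMetric I ∞ E (TangentSpace I : G → Type _)) : Prop :=
  ∀ (a x : G) (u v : TangentSpace I x),
    g.inner (a * x) (mfderiv I I (fun y : G => a * y) x u)
      (mfderiv I I (fun y : G => a * y) x v) = g.inner x u v

theorem isVonNBounded_of_pos [FiniteDimensional ℝ E] (B : E →L[ℝ] E →L[ℝ] ℝ)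
    (hB : ∀ v, v ≠ 0 → 0 < B v v) : Bornology.IsVonNBounded ℝ {v : E | B v v < 1} := by
  rw [NormedSpace.isVonNBounded_iff, isBounded_iff_forall_norm_le]
  have hc : Continuous fun v : E => B v v := by fun_prop
  rcases (Metric.sphere (0 : E) 1).eq_empty_or_nonempty with h | h
  · refine ⟨0, fun v _ => ?_⟩
    by_contra! hv
    have : ‖v‖⁻¹ • v ∈ Metric.sphere (0 : E) 1 := by
      simp [norm_smul, inv_mul_cancel₀ hv.ne']
    simp [h] at this
  · obtain ⟨e, he, hmin⟩ := (isCompact_sphere (0 : E) 1).exists_isMinOn h hc.continuousOn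
    have hm : 0 < B e e := hB e (by rintro rfl; simp at he)
    refine ⟨(B e e)⁻¹ + 1, fun v (hv : B v v < 1) => ?_⟩
    by_contra! hlt
    have hi : 0 < (B e e)⁻¹ := inv_pos.2 hm
    have h0 : 0 < ‖v‖ := by linarith
    have hs : ‖v‖⁻¹ • v ∈ Metric.sphere (0 : E) 1 := by
      simp [norm_smul, inv_mul_cancel₀ h0.ne']
    have h1 : B e e ≤ ‖v‖⁻¹ * (‖v‖⁻¹ * B v v) := by simpa using! hmin hs
    have h2 : B e e * (‖v‖ * ‖v‖) ≤ B v v := by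
      calc B e e * (‖v‖ * ‖v‖) ≤ ‖v‖⁻¹ * (‖v‖⁻¹ * B v v) * (‖v‖ * ‖v‖) := by gcongr
        _ = B v v := by field_simp
    have h3 : 1 ≤ B e e * ‖v‖ := by
      rw [← mul_inv_cancel₀ hm.ne']; gcongr; linarith
    nlinarith

variable [LieGroup I ∞ G]

/-- The derivative at `x` of the left translation by `x⁻¹`, from `T_x G` to `T_e G`. -/
def leftTrivialization (x : G) : E →L[ℝ] E :=
  mfderiv I I (fun y : G => x⁻¹ * y) x

/-- The bilinear form `(u, v) ↦ B (x⁻¹ u, x⁻¹ v)` on `T_x G` obtained from the bilinear form `B` on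
`T_e G` by left translation. -/
def leftForm (B : E →L[ℝ] E →L[ℝ] ℝ) (x : G) :
    TangentSpace I x →L[ℝ] TangentSpace I x →L[ℝ] ℝ :=
  show E →L[ℝ] E →L[ℝ] ℝ from
    B.bilinearComp (leftTrivialization (I := I) x) (leftTrivialization (I := I) x)

theorem leftTrivialization_injective (x : G) (v : E)
    (hv : leftTrivialization (I := I) x v = 0) : v = 0 := by
  have c := mfderiv_comp (I' := I) x (mdiff_left (I := I) x (x⁻¹ * x)) (mdiff_left (I := I) x⁻¹ x)
  have f : (fun t : G => x * t) ∘ (fun t : G => x⁻¹ * t) = id := by funext t; simp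
  rw [f, mfderiv_id] at c
  have d : v = mfderiv I I (fun t : G => x * t) (x⁻¹ * x) (leftTrivialization (I := I) x v) :=
    DFunLike.congr_fun c v
  rw [d, hv]
  exact map_zero (mfderiv I I (fun t : G => x * t) (x⁻¹ * x))

theorem contMDiff_leftForm (B : E →L[ℝ] E →L[ℝ] ℝ) :
    ContMDiff I (I.prod 𝓘(ℝ, E →L[ℝ] E →L[ℝ] ℝ)) ∞
      (fun x : G => TotalSpace.mk' (E →L[ℝ] E →L[ℝ] ℝ)
        (E := fun x : G => TangentSpace I x →L[ℝ] TangentSpace I x →L[ℝ] ℝ) x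
        (leftForm (I := I) B x)) := by
  intro x₀
  rw [contMDiffAt_hom_bundle]
  refine ⟨contMDiffAt_id, ?_⟩
  let A : G → E →L[ℝ] E := inTangentCoordinates I I id (fun x : G => x⁻¹ * x)
    (fun x => mfderiv I I (fun y : G => x⁻¹ * y) x) x₀
  have hA : ContMDiffAt I 𝓘(ℝ, E →L[ℝ] E) ∞ A x₀ := by
    refine ContMDiffAt.mfderiv (n := ∞) (fun x y : G => x⁻¹ * y) id ?_ contMDiffAt_id le_rfl
    exact ((contMDiff_inv I ∞).comp contMDiff_fst |>.mul contMDiff_snd).contMDiffAt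
  have hS : ContMDiffAt I 𝓘(ℝ, E →L[ℝ] E →L[ℝ] ℝ) ∞
      (fun x => B.bilinearComp (A x) (A x)) x₀ := by
    have hF : ContMDiff 𝓘(ℝ, E →L[ℝ] E →L[ℝ] ℝ) 𝓘(ℝ, E →L[ℝ] E →L[ℝ] ℝ) ∞
        (fun f : E →L[ℝ] E →L[ℝ] ℝ => f.flip) :=
      contMDiff_iff_contDiff.2
        (show ContDiff ℝ ∞ (ContinuousLinearMap.flipₗᵢ ℝ E E ℝ) from
          LinearIsometryEquiv.contDiff _)
    have h1 : ContMDiffAt I 𝓘(ℝ, E →L[ℝ] E →L[ℝ] ℝ) ∞ (fun x => B.comp (A x)) x₀ :=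
      contMDiffAt_const.clm_comp hA
    have h2 := (hF.contMDiffAt.comp x₀ h1).clm_comp hA
    exact hF.contMDiffAt.comp x₀ h2
  refine hS.congr_of_eventuallyEq ?_
  filter_upwards [(chartAt H x₀).open_source.mem_nhds (mem_chart_source H x₀)] with x hx
  have hx' : x ∈ (trivializationAt E (TangentSpace I : G → Type _) x₀).baseSet := hx
  have key : ∀ v : E, A x v = leftTrivialization (I := I) x
      ((trivializationAt E (TangentSpace I : G → Type _) x₀).symm x v) := by
    intro v
    have e1 : (x₀⁻¹ * x₀ : G) = x⁻¹ * x := by simp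
    have e2 := inTangentCoordinates_eq (I := I) (I' := I) id (fun x : G => x⁻¹ * x)
      (fun x => mfderiv I I (fun y : G => x⁻¹ * y) x) (x₀ := x₀) (x := x) hx
      (by rw [e1]; exact mem_chart_source H _)
    have e3 := (tangentBundleCore I G).coordChange_self (achart H (x⁻¹ * x)) (x⁻¹ * x)
      (mem_chart_source H _)
    have e4 := DFunLike.congr_fun (TangentBundle.symmL_trivializationAt_eq_core (I := I) hx) v
    refine (DFunLike.congr_fun e2 v).trans ?_
    rw [e1]
    refine (e3 _).trans ?_
    have e5 : (tangentBundleCore I G).coordChange (achart H x₀) (achart H x) x v =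
        (trivializationAt E (TangentSpace I : G → Type _) x₀).symm x v :=
      e4.symm.trans (Trivialization.symmL_apply _ hx' _)
    exact congrArg (fun t : E => leftTrivialization (I := I) x t) e5
  ext v w
  refine (inCoordinates_apply_eq₂ hx' hx' (by simp)).trans ?_
  rw [ContinuousLinearMap.bilinearComp_apply, key, key]
  simp
  rfl

/-- The left-invariant Riemannian metric on `G` whose value at the identity is the inner product
`B` on `T_e G`. -/
def leftInvariantMetric [FiniteDimensional ℝ E] (B : E →L[ℝ] E →L[ℝ] ℝ)
    (hsymm : ∀ u v, B u v = B v u) (hpos : ∀ v, v ≠ 0 → 0 < B v v) :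
    ContMDiffRiemannianMetric I ∞ E (TangentSpace I : G → Type _) where
  inner := leftForm B
  symm _ _ _ := hsymm _ _
  pos x v hv := hpos _ fun h => hv (leftTrivialization_injective (E := E) x v h)
  isVonNBounded x := by
    have h := isVonNBounded_of_pos (E := E)
      (B.bilinearComp (leftTrivialization (I := I) x) (leftTrivialization (I := I) x))
      fun v hv => hpos _ fun h => hv (leftTrivialization_injective x v h)
    exact h
  contMDiff := contMDiff_leftForm B

/-- The inner product `((a, b), (a', b')) ↦ g_e (a, a') + g_e (b, b')` on the tangent space of `TG`
at its identity `0 ∈ T_e G`. That space is `T_e G × T_e G`: the first factor consists of the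
vectors tangent to the zero section and the second one of the vertical vectors. -/
def tangentForm (g : ContMDiffRiemannianMetric I ∞ E (TangentSpace I : G → Type _)) :
    E × E →L[ℝ] E × E →L[ℝ] ℝ :=
  let B : E →L[ℝ] E →L[ℝ] ℝ := g.inner 1
  B.bilinearComp (ContinuousLinearMap.fst ℝ E E) (ContinuousLinearMap.fst ℝ E E) +
    B.bilinearComp (ContinuousLinearMap.snd ℝ E E) (ContinuousLinearMap.snd ℝ E E)

theorem tangentForm_symm (g : ContMDiffRiemannianMetric I ∞ E (TangentSpace I : G → Type _))
    (u v : E × E) : tangentForm g u v = tangentForm g v u :=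
  congrArg₂ (· + ·) (g.symm 1 u.1 v.1) (g.symm 1 u.2 v.2)

theorem tangentForm_pos (g : ContMDiffRiemannianMetric I ∞ E (TangentSpace I : G → Type _))
    (v : E × E) (hv : v ≠ 0) : 0 < tangentForm g v v := by
  have h0 : ∀ a : E, 0 ≤ g.inner 1 a a := fun a => by
    by_cases ha : a = 0
    · subst ha; exact (map_zero (g.inner 1 (0 : E))).ge
    · exact (g.pos 1 a ha).le
  by_cases h : v.1 = 0
  · have h2 : v.2 ≠ 0 := fun h2 => hv (Prod.ext h h2)
    exact add_pos_of_nonneg_of_pos (h0 v.1) (g.pos 1 v.2 h2)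
  · exact add_pos_of_pos_of_nonneg (g.pos 1 v.1 h) (h0 v.2)

/-- The left-invariant Riemannian metric `g̃` on the tangent Lie group `TG` induced by the
left-invariant Riemannian metric `g` on `G`. -/
def tangentMetric [FiniteDimensional ℝ E]
    (g : ContMDiffRiemannianMetric I ∞ E (TangentSpace I : G → Type _)) :
    ContMDiffRiemannianMetric I.tangent ∞ (E × E)
      (TangentSpace I.tangent : TangentBundle I G → Type _) :=
  leftInvariantMetric (tangentForm g) (tangentForm_symm g) (tangentForm_pos g)

/-- `h` is the metric on `TG` lifted from `g`: it is left-invariant and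
`h (X^c, Y^c) = h (X^v, Y^v) = g (X, Y)`, `h (X^c, Y^v) = 0` for all left-invariant vector fields
`X`, `Y` on `G`. -/
structure IsLiftedMetric (g : ContMDiffRiemannianMetric I ∞ E (TangentSpace I : G → Type _))
    (h : ContMDiffRiemannianMetric I.tangent ∞ (E × E)
      (TangentSpace I.tangent : TangentBundle I G → Type _)) : Prop where
  isLeftInvariant : IsLeftInvariant h
  complete_complete : ∀ (x y : GroupLieAlgebra I G) (w : TangentBundle I G),
    h.inner w (completeLift (mulInvariantVectorField x) w)
        (completeLift (mulInvariantVectorField y) w) =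
      g.inner w.proj (mulInvariantVectorField x w.proj) (mulInvariantVectorField y w.proj)
  vertical_vertical : ∀ (x y : GroupLieAlgebra I G) (w : TangentBundle I G),
    h.inner w (verticalLift (mulInvariantVectorField x) w)
        (verticalLift (mulInvariantVectorField y) w) =
      g.inner w.proj (mulInvariantVectorField x w.proj) (mulInvariantVectorField y w.proj)
  complete_vertical : ∀ (x y : GroupLieAlgebra I G) (w : TangentBundle I G),
    h.inner w (completeLift (mulInvariantVectorField x) w)
        (verticalLift (mulInvariantVectorField y) w) = 0

end Metric

/-! ### Special Lie groups -/

variable (I G) in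
/-- `G` is a special Lie group: its Lie algebra is not abelian, and `[x, y]` is a linear combination
of `x` and `y` for all `x`, `y` in the Lie algebra. -/
def IsSpecial : Prop :=
  (∃ x y : GroupLieAlgebra I G, ⁅x, y⁆ ≠ 0) ∧
    ∀ x y : GroupLieAlgebra I G, ∃ a b : ℝ, ⁅x, y⁆ = a • x + b • y

end TangentLie

end

open TangentLie

/-!
For a left-invariant metric everything reduces to the Lie algebra. In the left trivialization
`TG = G × T_e G`, a bilinear product `Γ` on `T_e G` defines a connection `d + Γ`
(`leftConnection`). It is the Levi-Civita connection when `Γ a b - Γ b a = [a, b]` and every `Γ a`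
is skew-adjoint for the inner product `B = g_e` (`isLeviCivita_leftConnection`), and then the
sectional curvature of the plane of `x a`, `x b` in `T_x G` is
`B(R(a, b) b, a) / (B(a, a) B(b, b) - B(a, b)²)` with
`R(a, b) c = Γ_a Γ_b c - Γ_b Γ_a c - Γ_[a, b] c` (`sectionalCurvature_leftDeriv`). The curvature in
the definition is computed from arbitrary local extensions of tangent vectors and an arbitrary
Levi-Civita connection. Two Levi-Civita connections agree on differentiable fields
(`IsLeviCivita.eq`), and the derivatives of the extensions cancel because a bracket of vector fields
acts on functions as a commutator (`dirDeriv_mlieBracket`).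

The second ingredient is the Lie algebra of the tangent group: it is the semidirect product
`[(a, b), (a', b')] = ([a, a'], [a, b'] + [b, a'])` (`lieBr_tangent`). This is read off from the
action of left-invariant fields of `TG` on the functions `f ∘ π` and `df`, for `f` smooth on `G`
(`leftDer_comp_proj`, `leftDer_tdiff`), whose differentials separate tangent vectors.

The flow of a left-invariant field consists of right translations, so the complete and the vertical
lift of the left-invariant field with value `a` are the left-invariant fields of `TG` with values
`(a, 0)` and `(0, a)` (`completeLift_mulInvariantVectorField`,
`verticalLift_mulInvariantVectorField`). Hence `g̃` is the lifted metric.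

Finally, in a special Lie algebra `ad x` acts on the quotient by `x` as a scalar `l(x)`, which is a
multiple of the trace of `ad x` and therefore linear in `x`, and `[x, y] = l(x) y - l(y) x`
(`exists_dual_of_bracket_mem_span`). Let `ξ` represent `l` with respect to `B`. On `G` the product
`Γ_x y = B(x, y) ξ - B(ξ, y) x` gives constant curvature `-B(ξ, ξ)`. On `TG` there is a similar
formula (`specialTangentProduct`), and for a vector `e ≠ 0` orthogonal to `ξ` the planes of
`(0, ξ), (0, e)`, of `(ξ, 0), (e, 0)` and of `(ξ, 0), (0, ξ)` have positive, negative and zero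
curvature.
-/

noncomputable section

namespace TangentLie

/-! ### Derivations and Lie brackets of vector fields -/

section Derivations

variable {E : Type*} [NormedAddCommGroup E] [NormedSpace ℝ E]
  {H : Type*} [TopologicalSpace H] {I : ModelWithCorners ℝ E H}
  {M : Type*} [TopologicalSpace M] [ChartedSpace H M]
  {F : Type*} [NormedAddCommGroup F] [NormedSpace ℝ F]

/-- The derivative `X f` of a vector-valued function `f` along a vector field `X`. -/
def dirDeriv (f : M → F) (X : (x : M) → TangentSpace I x) (x : M) : F :=
  mfderiv I 𝓘(ℝ, F) f x (X x)

theorem contMDiffAt_dirDeriv [IsManifold I ∞ M] {n : ℕ} {f : M → F}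
    {X : (x : M) → TangentSpace I x} {x : M}
    (hf : ContMDiffAt I 𝓘(ℝ, F) (n + 1 : ℕ) f x)
    (hX : ContMDiffAt I I.tangent n (fun y => (⟨y, X y⟩ : TangentBundle I M)) x) :
    ContMDiffAt I 𝓘(ℝ, F) n (dirDeriv f X) x := by
  obtain ⟨u, hu, hfu⟩ := (contMDiffAt_iff_contMDiffOn_nhds (by simp)).1 hf
  obtain ⟨v, hv, hXv⟩ := (contMDiffAt_iff_contMDiffOn_nhds (by simp)).1 hX
  obtain ⟨w, hw, hwo, hxw⟩ := mem_nhds_iff.1 (inter_mem hu hv)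
  have h1 := (hfu.mono (hw.trans Set.inter_subset_left)).contMDiffOn_tangentMapWithin
    (m := n) (by norm_cast) hwo.uniqueMDiffOn
  have h2 := h1.comp (hXv.mono (hw.trans Set.inter_subset_right)) (fun y hy => hy)
  have h3 := (contMDiff_snd_tangentBundle_modelSpace F 𝓘(ℝ, F) (n := n)).comp_contMDiffOn h2
  refine (h3.contMDiffAt (hwo.mem_nhds hxw)).congr_of_eventuallyEq ?_
  filter_upwards [hwo.mem_nhds hxw] with y hy
  simp only [dirDeriv, Function.comp, tangentMapWithin, mfderivWithin_of_isOpen hwo hy]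
  rfl

theorem contMDiff_dirDeriv [IsManifold I ∞ M] {f : M → F}
    {X : (x : M) → TangentSpace I x}
    (hf : ContMDiff I 𝓘(ℝ, F) ∞ f)
    (hX : ContMDiff I I.tangent ∞ (fun y => (⟨y, X y⟩ : TangentBundle I M))) :
    ContMDiff I 𝓘(ℝ, F) ∞ (dirDeriv f X) :=
  (contMDiff_snd_tangentBundle_modelSpace F 𝓘(ℝ, F)).comp
    ((hf.contMDiff_tangentMap le_rfl).comp hX)

theorem dirDeriv_clm_comp {F' : Type*} [NormedAddCommGroup F'] [NormedSpace ℝ F'] (φ : F →L[ℝ] F')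
    {f : M → F} {X : (x : M) → TangentSpace I x} {x : M}
    (hf : MDifferentiableAt I 𝓘(ℝ, F) f x) :
    dirDeriv (fun y => φ (f y)) X x = φ (dirDeriv f X x) := by
  have h : HasMFDerivAt I 𝓘(ℝ, F') (fun y => φ (f y)) x _ :=
    (φ.hasMFDerivAt).comp x hf.hasMFDerivAt
  unfold dirDeriv
  rw [h.mfderiv]
  rfl

variable [IsManifold I ∞ M]

theorem isManifold_minSmoothness (k : ℕ) : IsManifold I (minSmoothness ℝ k) M := by
  rw [minSmoothness_of_isRCLikeNormedField]
  exact IsManifold.of_le (n := ∞) (mod_cast le_top)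

variable [CompleteSpace E]

open VectorField

/-- The Leibniz rule applied twice, for the bracket of `Y` with the bracket of `X` and `f Z`. -/
theorem mlieBracket_mlieBracket_smul {f : M → ℝ} {X Y Z : (x : M) → TangentSpace I x} {x : M}
    (hf : ContMDiffAt I 𝓘(ℝ, ℝ) 2 f x)
    (hX : ContMDiffAt I I.tangent 2 (fun y => (⟨y, X y⟩ : TangentBundle I M)) x)
    (hZ : ContMDiffAt I I.tangent 2 (fun y => (⟨y, Z y⟩ : TangentBundle I M)) x) :
    mlieBracket I Y (mlieBracket I X (f • Z)) x =
      dirDeriv (dirDeriv f X) Y x • Z x + dirDeriv f X x • mlieBracket I Y Z x +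
        (dirDeriv f Y x • mlieBracket I X Z x +
          f x • mlieBracket I Y (mlieBracket I X Z) x) := by
  have : IsManifold I (minSmoothness ℝ 2) M := isManifold_minSmoothness 2
  have hZ1 := hZ.mdifferentiableAt (by simp)
  have hf1 := hf.mdifferentiableAt (by simp)
  have hXf : MDifferentiableAt I 𝓘(ℝ, ℝ) (dirDeriv f X) x :=
    (contMDiffAt_dirDeriv (n := 1) hf (hX.of_le (by norm_cast))).mdifferentiableAt (by simp)
  have hXZ : MDifferentiableAt I I.tangent
      (fun y => (⟨y, mlieBracket I X Z y⟩ : TangentBundle I M)) x := by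
    have : IsManifold I ((2 : ℕ∞) + 1) M := IsManifold.of_le (n := ∞) (mod_cast le_top)
    refine (ContMDiffAt.mlieBracket_vectorField (m := 1) (n := 2) hX hZ ?_).mdifferentiableAt
      (by simp)
    rw [minSmoothness_of_isRCLikeNormedField]
    norm_cast
  have ev : mlieBracket I X (f • Z) =ᶠ[𝓝 x] dirDeriv f X • Z + f • mlieBracket I X Z := by
    filter_upwards [(contMDiffAt_iff_contMDiffAt_nhds (by simp)).1 hf,
      (contMDiffAt_iff_contMDiffAt_nhds (by simp)).1 hZ] with y hfy hZy
    exact mlieBracket_smul_right (hfy.mdifferentiableAt (by simp)) (hZy.mdifferentiableAt (by simp))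
  rw [(EventuallyEq.refl (𝓝 x) Y).mlieBracket_vectorField_eq ev,
    mlieBracket_add_right (hXf.smul_section hZ1) (hf1.smul_section hXZ),
    mlieBracket_smul_right hXf hZ1, mlieBracket_smul_right hf1 hXZ]
  rfl

/-- The Lie bracket acts on scalar functions as the commutator of derivations. The Jacobi identity
for `X`, `Y` and `f Z`, expanded by the Leibniz rule, reads `(X Y f - Y X f) Z = ([X, Y] f) Z`. -/
theorem dirDeriv_mlieBracket_real {f : M → ℝ} {X Y : (x : M) → TangentSpace I x} {x : M}
    (hf : ContMDiffAt I 𝓘(ℝ, ℝ) 2 f x)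
    (hX : ContMDiffAt I I.tangent 2 (fun y => (⟨y, X y⟩ : TangentBundle I M)) x)
    (hY : ContMDiffAt I I.tangent 2 (fun y => (⟨y, Y y⟩ : TangentBundle I M)) x) :
    dirDeriv f (mlieBracket I X Y) x =
      dirDeriv (dirDeriv f Y) X x - dirDeriv (dirDeriv f X) Y x := by
  have : IsManifold I (minSmoothness ℝ 3) M := isManifold_minSmoothness 3
  -- the argument needs a nonzero tangent vector at `x` in the role of `Z`
  by_cases hE : mlieBracket I X Y x = 0 ∧ X x = 0 ∧ Y x = 0
  · have h0 : ∀ (h : M → ℝ) (W : (x : M) → TangentSpace I x), W x = 0 → dirDeriv h W x = 0 :=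
      fun h W hW => (congrArg (mfderiv I 𝓘(ℝ, ℝ) h x) hW).trans (map_zero _)
    rw [h0 _ _ hE.1, h0 _ _ hE.2.1, h0 _ _ hE.2.2, sub_zero]
  obtain ⟨z, hz⟩ : ∃ z : TangentSpace I x, z ≠ 0 := by
    by_contra! h
    exact hE ⟨h _, h _, h _⟩
  let Z : (y : M) → TangentSpace I y := FiberBundle.extend E z
  have hZ : ContMDiffAt I I.tangent 2 (fun y => (⟨y, Z y⟩ : TangentBundle I M)) x :=
    FiberBundle.contMDiffAt_extend I E z
  have hZx : Z x = z := FiberBundle.extend_apply_self E z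
  have hs : minSmoothness ℝ 2 = 2 := minSmoothness_of_isRCLikeNormedField
  have J1 := leibniz_identity_mlieBracket_apply (I := I) (U := X) (V := Y) (W := f • Z) (x := x)
    (by rwa [hs]) (by rwa [hs]) (by rw [hs]; exact hf.smul_section hZ)
  have J2 := leibniz_identity_mlieBracket_apply (I := I) (U := X) (V := Y) (W := Z) (x := x)
    (by rwa [hs]) (by rwa [hs]) (by rwa [hs])
  rw [mlieBracket_mlieBracket_smul hf hX hZ, mlieBracket_mlieBracket_smul hf hY hZ,
    mlieBracket_smul_right (hf.mdifferentiableAt (by simp)) (hZ.mdifferentiableAt (by simp)), J2,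
    hZx] at J1
  have key : (dirDeriv f (mlieBracket I X Y) x -
      (dirDeriv (dirDeriv f Y) X x - dirDeriv (dirDeriv f X) Y x)) • z = 0 := by
    have J3 : dirDeriv (dirDeriv f Y) X x • z + dirDeriv f Y x • mlieBracket I X Z x +
      (dirDeriv f X x • mlieBracket I Y Z x + f x • (mlieBracket I (mlieBracket I X Y) Z x +
        mlieBracket I Y (mlieBracket I X Z) x)) =
      dirDeriv f (mlieBracket I X Y) x • z + f x • mlieBracket I (mlieBracket I X Y) Z x +
      (dirDeriv (dirDeriv f X) Y x • z + dirDeriv f X x • mlieBracket I Y Z x +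
        (dirDeriv f Y x • mlieBracket I X Z x + f x • mlieBracket I Y (mlieBracket I X Z) x)) := J1
    rw [sub_smul, sub_smul, sub_eq_zero, ← sub_eq_zero]
    rw [← sub_eq_zero] at J3
    rw [← neg_eq_zero, ← J3]
    module
  exact sub_eq_zero.1 ((smul_eq_zero.1 key).resolve_right hz)

/-- The Lie bracket acts on vector-valued functions as the commutator of derivations. -/
theorem dirDeriv_mlieBracket {F : Type*} [NormedAddCommGroup F] [NormedSpace ℝ F]
    {f : M → F} {X Y : (x : M) → TangentSpace I x} {x : M}
    (hf : ContMDiffAt I 𝓘(ℝ, F) 2 f x)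
    (hX : ContMDiffAt I I.tangent 2 (fun y => (⟨y, X y⟩ : TangentBundle I M)) x)
    (hY : ContMDiffAt I I.tangent 2 (fun y => (⟨y, Y y⟩ : TangentBundle I M)) x) :
    dirDeriv f (mlieBracket I X Y) x =
      dirDeriv (dirDeriv f Y) X x - dirDeriv (dirDeriv f X) Y x := by
  refine (SeparatingDual.eq_iff_forall_dual_eq (R := ℝ)).2 fun φ => ?_
  have comp2 : ∀ V W : (x : M) → TangentSpace I x,
      ContMDiffAt I I.tangent 2 (fun y => (⟨y, V y⟩ : TangentBundle I M)) x →
      dirDeriv (dirDeriv (fun y => φ (f y)) V) W x = φ (dirDeriv (dirDeriv f V) W x) := by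
    intro V W hV
    have hd : MDifferentiableAt I 𝓘(ℝ, F) (dirDeriv f V) x :=
      (contMDiffAt_dirDeriv (n := 1) hf (hV.of_le (by norm_cast))).mdifferentiableAt (by simp)
    rw [← dirDeriv_clm_comp φ hd]
    refine congrArg (fun L : TangentSpace I x →L[ℝ] ℝ => L (W x)) (EventuallyEq.mfderiv_eq ?_)
    filter_upwards [(contMDiffAt_iff_contMDiffAt_nhds (by simp)).1 hf] with y hy
    exact dirDeriv_clm_comp φ (hy.mdifferentiableAt (by simp))
  have hφf : ContMDiffAt I 𝓘(ℝ, ℝ) 2 (fun y => φ (f y)) x :=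
    φ.contMDiff.contMDiffAt.comp x hf
  rw [map_sub, ← comp2 Y X hY, ← comp2 X Y hX,
    ← dirDeriv_clm_comp φ (hf.mdifferentiableAt (by simp)), dirDeriv_mlieBracket_real hφf hX hY]

end Derivations

/-! ### Mixed partial derivatives on products of manifolds -/

section MixedPartials

variable {E : Type*} [NormedAddCommGroup E] [NormedSpace ℝ E]
  {H : Type*} [TopologicalSpace H] {I : ModelWithCorners ℝ E H}
  {M : Type*} [TopologicalSpace M] [ChartedSpace H M] [IsManifold I ∞ M]
  {E' : Type*} [NormedAddCommGroup E'] [NormedSpace ℝ E']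
  {H' : Type*} [TopologicalSpace H'] {I' : ModelWithCorners ℝ E' H'}
  {N : Type*} [TopologicalSpace N] [ChartedSpace H' N] [IsManifold I' ∞ N]
  {F : Type*} [NormedAddCommGroup F] [NormedSpace ℝ F]

/-- Every tangent vector is the velocity of a smooth curve. -/
theorem exists_curve [I.Boundaryless] (x : M) (w : TangentSpace I x) :
    ∃ σ : ℝ → M, ContMDiffAt 𝓘(ℝ, ℝ) I ∞ σ 0 ∧ σ 0 = x ∧
      (mfderiv 𝓘(ℝ, ℝ) I σ 0 (1 : ℝ) : E) = w := by
  let φ := extChartAt I x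
  let w' : E := mfderiv I 𝓘(ℝ, E) φ x w
  let l : ℝ → E := fun t => φ x + t • w'
  have hl : ContDiff ℝ ∞ l := by fun_prop
  have hl0 : l 0 = φ x := by simp [l]
  have hld : HasFDerivAt l ((1 : ℝ →L[ℝ] ℝ).smulRight w') 0 :=
    (((1 : ℝ →L[ℝ] ℝ).smulRight w').hasFDerivAt).const_add (φ x)
  have hs : ContMDiffAt 𝓘(ℝ, E) I ∞ φ.symm (l 0) := by
    rw [hl0]
    exact (contMDiffOn_extChartAt_symm x).contMDiffAt
      ((isOpen_extChartAt_target x).mem_nhds (mem_extChartAt_target x))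
  refine ⟨φ.symm ∘ l, hs.comp 0 hl.contMDiff.contMDiffAt, by simp [hl0, φ], ?_⟩
  have hc := mfderiv_comp (I' := 𝓘(ℝ, E)) (0 : ℝ) (hs.mdifferentiableAt (by simp))
    hld.hasMFDerivAt.mdifferentiableAt
  rw [hld.hasMFDerivAt.mfderiv] at hc
  have h2 := mfderivWithin_extChartAt_symm_comp_mfderiv_extChartAt' (I := I)
    (mem_extChartAt_source (I := I) x)
  rw [I.range_eq_univ, mfderivWithin_univ] at h2
  have h3 : mfderiv 𝓘(ℝ, E) I φ.symm (φ x) w' = w := DFunLike.congr_fun h2 w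
  refine (DFunLike.congr_fun hc (1 : ℝ)).trans ?_
  rw [← hl0] at h3
  refine Eq.trans ?_ h3
  exact congrArg (fun t : E => (mfderiv 𝓘(ℝ, E) I φ.symm (l 0) t : E)) (one_smul ℝ w')

omit [IsManifold I ∞ M] in
theorem mfderiv_apply_velocity {f : M → F} {σ : ℝ → M} {x : M} {w : TangentSpace I x}
    (h0 : σ 0 = x)
    (hσ : MDifferentiableAt 𝓘(ℝ, ℝ) I σ 0) (hw : (mfderiv 𝓘(ℝ, ℝ) I σ 0 (1 : ℝ) : E) = w)
    (hf : MDifferentiableAt I 𝓘(ℝ, F) f x) :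
    (mfderiv I 𝓘(ℝ, F) f x w : F) = deriv (fun s => f (σ s)) 0 := by
  subst h0
  have hc := mfderiv_comp (I' := I) (0 : ℝ) hf hσ
  rw [← fderiv_apply_one_eq_deriv, ← mfderiv_eq_fderiv]
  exact (congrArg (fun t : E => (mfderiv I 𝓘(ℝ, F) f (σ 0) t : F)) hw.symm).trans
    (DFunLike.congr_fun hc (1 : ℝ)).symm

theorem deriv_deriv_comm {φ : ℝ × ℝ → F} (hφ : ContDiffAt ℝ 2 φ (0, 0)) :
    deriv (fun t => deriv (fun s => φ (s, t)) 0) 0 =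
      deriv (fun s => deriv (fun t => φ (s, t)) 0) 0 := by
  have hd : ∀ᶠ p in 𝓝 ((0 : ℝ), (0 : ℝ)), DifferentiableAt ℝ φ p := by
    have := hφ.eventually (by simp)
    filter_upwards [this] with p hp using hp.differentiableAt (by simp)
  have hdd : DifferentiableAt ℝ (fderiv ℝ φ) (0, 0) :=
    (hφ.fderiv_right (m := 1) (by norm_num)).differentiableAt (by simp)
  have hsymm := (hφ.isSymmSndFDerivAt (by simp)) (0, 1) (1, 0)
  have e1 : (fun t => deriv (fun s => φ (s, t)) 0) =ᶠ[𝓝 0] fun t => fderiv ℝ φ (0, t) (1, 0) := by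
    have hc : Tendsto (fun t : ℝ => ((0 : ℝ), t)) (𝓝 0) (𝓝 (0, 0)) :=
      Continuous.tendsto (by fun_prop) _
    filter_upwards [hc.eventually hd] with t ht
    exact (ht.hasFDerivAt.comp_hasDerivAt (0 : ℝ)
      ((hasDerivAt_id (0 : ℝ)).prodMk (hasDerivAt_const (0 : ℝ) t))).deriv
  have e2 : (fun s => deriv (fun t => φ (s, t)) 0) =ᶠ[𝓝 0] fun s => fderiv ℝ φ (s, 0) (0, 1) := by
    have hc : Tendsto (fun s : ℝ => (s, (0 : ℝ))) (𝓝 0) (𝓝 (0, 0)) :=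
      Continuous.tendsto (by fun_prop) _
    filter_upwards [hc.eventually hd] with s hs
    exact (hs.hasFDerivAt.comp_hasDerivAt (0 : ℝ)
      ((hasDerivAt_const (0 : ℝ) s).prodMk (hasDerivAt_id (0 : ℝ)))).deriv
  have h1 := (hdd.hasFDerivAt.comp_hasDerivAt (f := fun t : ℝ => ((0 : ℝ), t)) (0 : ℝ)
      ((hasDerivAt_const (0 : ℝ) (0 : ℝ)).prodMk (hasDerivAt_id (0 : ℝ)))).clm_apply
      (hasDerivAt_const (0 : ℝ) ((1 : ℝ), (0 : ℝ)))
  have h2 := (hdd.hasFDerivAt.comp_hasDerivAt (f := fun s : ℝ => (s, (0 : ℝ))) (0 : ℝ)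
      ((hasDerivAt_id (0 : ℝ)).prodMk (hasDerivAt_const (0 : ℝ) (0 : ℝ)))).clm_apply
      (hasDerivAt_const (0 : ℝ) ((0 : ℝ), (1 : ℝ)))
  rw [e1.deriv_eq, e2.deriv_eq]
  refine h1.deriv.trans (Eq.trans ?_ h2.deriv.symm)
  simpa using hsymm

/-- The partial derivative of a smooth function on a product is smooth in the other variable. -/
theorem contMDiff_mfderiv_fst_apply {Φ : M × N → F} (hΦ : ContMDiff (I.prod I') 𝓘(ℝ, F) ∞ Φ)
    (x : M) (w : TangentSpace I x) :
    ContMDiff I' 𝓘(ℝ, F) ∞ fun y => (mfderiv I 𝓘(ℝ, F) (fun x => Φ (x, y)) x w : F) := by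
  have h1 : ContMDiff I' (I.tangent.prod I'.tangent) ∞
      fun y => ((⟨x, w⟩ : TangentBundle I M), zeroSection E' (TangentSpace I' : N → Type _) y) :=
    contMDiff_const.prodMk (contMDiff_zeroSection _ _)
  have h2 := (contMDiff_snd_tangentBundle_modelSpace F 𝓘(ℝ, F)).comp
    ((hΦ.contMDiff_tangentMap (m := ∞) le_rfl).comp
      (contMDiff_equivTangentBundleProd_symm.comp h1))
  refine h2.congr fun y => ?_
  have h := mfderiv_prod_eq_add_apply (p := (x, y)) (v := ((w, 0) : E × E'))
    (hΦ.mdifferentiableAt (x := (x, y)) (by simp))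
  refine Eq.trans ?_ h.symm
  refine Eq.trans (add_zero (M := F) _).symm ?_
  exact congrArg (HAdd.hAdd (α := F) (β := F) (γ := F) _)
    (map_zero (mfderiv I' 𝓘(ℝ, F) (fun z => Φ (x, z)) y)).symm

/-- A mixed second derivative on a product of manifolds, computed along a pair of curves. -/
theorem mfderiv_mfderiv_eq_deriv_deriv {Φ : M × N → F}
    (hΦ : ContMDiff (I.prod I') 𝓘(ℝ, F) ∞ Φ) {x : M} {y : N} {w : TangentSpace I x}
    {a : TangentSpace I' y} {σ : ℝ → M} {γ : ℝ → N} (hσ0 : σ 0 = x) (hγ0 : γ 0 = y)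
    (hσ : MDifferentiableAt 𝓘(ℝ, ℝ) I σ 0) (hγ : MDifferentiableAt 𝓘(ℝ, ℝ) I' γ 0)
    (hw : (mfderiv 𝓘(ℝ, ℝ) I σ 0 (1 : ℝ) : E) = w)
    (ha : (mfderiv 𝓘(ℝ, ℝ) I' γ 0 (1 : ℝ) : E') = a) :
    (mfderiv I' 𝓘(ℝ, F) (fun y => (mfderiv I 𝓘(ℝ, F) (fun x => Φ (x, y)) x w : F)) y a : F) =
      deriv (fun t => deriv (fun s => Φ (σ s, γ t)) 0) 0 := by
  rw [mfderiv_apply_velocity hγ0 hγ ha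
    ((contMDiff_mfderiv_fst_apply hΦ x w).mdifferentiableAt (by simp))]
  congr 1
  funext t
  refine mfderiv_apply_velocity hσ0 hσ hw ?_
  exact (hΦ.comp (contMDiff_id.prodMk contMDiff_const)).mdifferentiableAt (by simp)

/-- Symmetry of the mixed second derivatives on a product of manifolds. -/
theorem mfderiv_mfderiv_comm [I.Boundaryless] [I'.Boundaryless] {Φ : M × N → F}
    (hΦ : ContMDiff (I.prod I') 𝓘(ℝ, F) ∞ Φ) (x : M) (y : N) (w : TangentSpace I x)
    (a : TangentSpace I' y) :
    (mfderiv I' 𝓘(ℝ, F) (fun y => (mfderiv I 𝓘(ℝ, F) (fun x => Φ (x, y)) x w : F)) y a : F) =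
      (mfderiv I 𝓘(ℝ, F) (fun x => (mfderiv I' 𝓘(ℝ, F) (fun y => Φ (x, y)) y a : F)) x w : F) := by
  obtain ⟨σ, hσ, hσ0, hw⟩ := exists_curve x w
  obtain ⟨γ, hγ, hγ0, ha⟩ := exists_curve y a
  have hσ1 := hσ.mdifferentiableAt (by simp)
  have hγ1 := hγ.mdifferentiableAt (by simp)
  rw [mfderiv_mfderiv_eq_deriv_deriv hΦ hσ0 hγ0 hσ1 hγ1 hw ha]
  have hΦ' : ContMDiff (I'.prod I) 𝓘(ℝ, F) ∞ (fun p : N × M => Φ (p.2, p.1)) :=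
    hΦ.comp (contMDiff_snd.prodMk contMDiff_fst)
  refine Eq.trans ?_ (mfderiv_mfderiv_eq_deriv_deriv hΦ' hγ0 hσ0 hγ1 hσ1 ha hw).symm
  refine deriv_deriv_comm (φ := fun p : ℝ × ℝ => Φ (σ p.1, γ p.2)) ?_
  have h1 : ContMDiffAt (𝓘(ℝ, ℝ).prod 𝓘(ℝ, ℝ)) (I.prod I') ∞
      (fun p : ℝ × ℝ => (σ p.1, γ p.2)) (0, 0) :=
    (hσ.comp ((0 : ℝ), (0 : ℝ)) contMDiffAt_fst).prodMk
      (hγ.comp ((0 : ℝ), (0 : ℝ)) contMDiffAt_snd)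
  have h2 := (hΦ.contMDiffAt.comp ((0 : ℝ), (0 : ℝ)) h1).of_le (m := 2) (by norm_cast)
  rw [← modelWithCornersSelf_prod, chartedSpaceSelf_prod] at h2
  exact h2.contDiffAt

end MixedPartials

/-! ### Left trivialization of the tangent bundle -/

section Fiber

variable {E : Type*} [NormedAddCommGroup E] [NormedSpace ℝ E]
  {H : Type*} [TopologicalSpace H] {I : ModelWithCorners ℝ E H}
  {M : Type*} [TopologicalSpace M] [ChartedSpace H M] [IsManifold I ∞ M]
  {E' : Type*} [NormedAddCommGroup E'] [NormedSpace ℝ E']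
  {H' : Type*} [TopologicalSpace H'] {I' : ModelWithCorners ℝ E' H'}
  {N : Type*} [TopologicalSpace N] [ChartedSpace H' N]

theorem trivializationAt_self_snd (w : TangentBundle I M) {x : M} (hx : w.proj = x) :
    (trivializationAt E (TangentSpace I : M → Type _) x w).2 = w.2 := by
  subst hx
  exact (tangentBundleCore I M).coordChange_self (achart H w.proj) w.proj
    (mem_chart_source H w.proj) w.2

/-- A map into a single tangent space is smooth exactly when it is smooth as a map into the tangent
bundle. -/
theorem contMDiffAt_fiber_iff {n : ℕ∞ω} {x : M} {f : N → E} {y : N} :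
    ContMDiffAt I' I.tangent n (fun z => (⟨x, f z⟩ : TangentBundle I M)) y ↔
      ContMDiffAt I' 𝓘(ℝ, E) n f y := by
  rw [contMDiffAt_totalSpace]
  have h : (fun z => (trivializationAt E (TangentSpace I : M → Type _) x
      (⟨x, f z⟩ : TangentBundle I M)).2) = f :=
    funext fun z => trivializationAt_self_snd (I := I) ⟨x, f z⟩ rfl
  exact ⟨fun hf => h ▸ hf.2, fun hf => ⟨contMDiffAt_const, h.symm ▸ hf⟩⟩

/-- A map into a single tangent space is differentiable exactly when it is differentiable as a map
into the tangent bundle. -/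
theorem mdifferentiableAt_fiber_iff {x : M} {f : N → E} {y : N} :
    MDifferentiableAt I' I.tangent (fun z => (⟨x, f z⟩ : TangentBundle I M)) y ↔
      MDifferentiableAt I' 𝓘(ℝ, E) f y := by
  rw [mdifferentiableAt_totalSpace]
  have h : (fun z => (trivializationAt E (TangentSpace I : M → Type _) x
      (⟨x, f z⟩ : TangentBundle I M)).2) = f :=
    funext fun z => trivializationAt_self_snd (I := I) ⟨x, f z⟩ rfl
  exact ⟨fun hf => h ▸ hf.2, fun hf => ⟨mdifferentiableAt_const, h.symm ▸ hf⟩⟩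

variable (I) in
/-- The inclusion of the tangent space at `x` into the tangent bundle. -/
def fiberIncl (x : M) (v : E) : TangentBundle I M := ⟨x, v⟩

theorem contMDiff_fiberIncl (x : M) : ContMDiff 𝓘(ℝ, E) I.tangent ∞ (fiberIncl I x) :=
  fun _ => contMDiffAt_fiber_iff.2 contMDiffAt_id

theorem mfderiv_fiberIncl (x : M) (v : E) :
    (mfderiv 𝓘(ℝ, E) I.tangent (fiberIncl I x) 0 v : E × E) = (0, v) := by
  have A : MDifferentiableAt 𝓘(ℝ, E) I.tangent (fiberIncl I x) 0 :=
    (contMDiff_fiberIncl x).mdifferentiable (by simp) _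
  have h : writtenInExtChartAt 𝓘(ℝ, E) I.tangent 0 (fiberIncl I x) =
      fun t : E => (extChartAt I x x, t) := by
    funext t
    refine Prod.ext rfl ?_
    exact trivializationAt_self_snd (I := I) ⟨x, t⟩ rfl
  have hd : HasFDerivAt (fun t : E => (extChartAt I x x, t)) (ContinuousLinearMap.inr ℝ E E) 0 :=
    (hasFDerivAt_const (extChartAt I x x) (0 : E)).prodMk (hasFDerivAt_id (0 : E))
  have hm : HasMFDerivAt 𝓘(ℝ, E) I.tangent (fiberIncl I x) 0 (ContinuousLinearMap.inr ℝ E E) :=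
    ⟨A.continuousAt, h.symm ▸ hd.hasFDerivWithinAt⟩
  exact DFunLike.congr_fun hm.mfderiv v

variable (I) in
/-- The zero section of the tangent bundle. -/
def zeroSec (x : M) : TangentBundle I M := ⟨x, (0 : E)⟩

theorem contMDiff_zeroSec : ContMDiff I I.tangent ∞ (zeroSec I : M → TangentBundle I M) :=
  contMDiff_zeroSection ℝ (TangentSpace I : M → Type _)

theorem mfderiv_zeroSec (x : M) (v : E) :
    (mfderiv I I.tangent (zeroSec I) x v : E × E) = (v, 0) := by
  have h := TangentBundle.tangentMap_tangentBundle_pure (I := I) (⟨x, v⟩ : TangentBundle I M)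
  simp only [tangentMap] at h
  have h2 := (TotalSpace.mk_inj).1 h
  exact h2

end Fiber

section Translation

variable {E : Type*} [NormedAddCommGroup E] [NormedSpace ℝ E]
  {H : Type*} [TopologicalSpace H] {I : ModelWithCorners ℝ E H}
  {G : Type*} [TopologicalSpace G] [ChartedSpace H G] [Group G] [LieGroup I ∞ G]

variable (I) in
/-- The derivative at the identity of the left translation by `x`, from `T_e G` to `T_x G`. It is
the inverse of `leftTrivialization x`. -/
def leftDeriv (x : G) : E →L[ℝ] E := mfderiv I I (fun y : G => x * y) 1

variable (I) in
theorem mfderiv_mul_left_comp (a b c : G) (v : E) :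
    (mfderiv I I (fun y : G => a * y) (b * c) (mfderiv I I (fun y : G => b * y) c v) : E) =
      mfderiv I I (fun y : G => a * b * y) c v := by
  have h := mfderiv_comp (I' := I) c (mdiff_left (I := I) a (b * c)) (mdiff_left (I := I) b c)
  have f : (fun t : G => a * t) ∘ (fun t : G => b * t) = fun t => a * b * t := by
    funext t; simp [mul_assoc]
  rw [f] at h
  exact (DFunLike.congr_fun h v).symm

variable (I) in
omit [LieGroup I ∞ G] in
theorem mfderiv_mul_left_of_eq {a b : G} (hab : a = b) {x y : G} (hxy : x = y) (v : E) :
    (mfderiv I I (fun z : G => a * z) x v : E) = mfderiv I I (fun z : G => b * z) y v := by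
  subst hab; subst hxy; rfl

variable (I) in
omit [LieGroup I ∞ G] in
theorem mfderiv_one_mul (x : G) (v : E) : (mfderiv I I (fun z : G => 1 * z) x v : E) = v := by
  have f : (fun t : G => 1 * t) = id := by funext t; simp
  have c : mfderiv I I (fun t : G => 1 * t) x = ContinuousLinearMap.id ℝ E := by
    rw [f]; exact mfderiv_id
  exact DFunLike.congr_fun c v

theorem leftTrivialization_leftDeriv (x : G) (v : E) :
    leftTrivialization (I := I) x (leftDeriv I x v) = v :=
  (mfderiv_mul_left_of_eq I rfl (mul_one x).symm _).trans
    ((mfderiv_mul_left_comp I x⁻¹ x 1 v).trans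
      ((mfderiv_mul_left_of_eq I (inv_mul_cancel x) rfl v).trans (mfderiv_one_mul I 1 v)))

theorem leftDeriv_leftTrivialization (x : G) (v : E) :
    leftDeriv I x (leftTrivialization (I := I) x v) = v :=
  (mfderiv_mul_left_of_eq I rfl (inv_mul_cancel x).symm _).trans
    ((mfderiv_mul_left_comp I x x⁻¹ x v).trans
      ((mfderiv_mul_left_of_eq I (mul_inv_cancel x) rfl v).trans (mfderiv_one_mul I x v)))

theorem leftTrivialization_mul (a x : G) (v : E) :
    leftTrivialization (I := I) (a * x) (mfderiv I I (fun y : G => a * y) x v) =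
      leftTrivialization (I := I) x v :=
  (mfderiv_mul_left_comp I (a * x)⁻¹ a x v).trans
    (mfderiv_mul_left_of_eq I (by simp) rfl v)

omit [LieGroup I ∞ G] in
theorem leftDeriv_one (v : E) : leftDeriv I (1 : G) v = v := mfderiv_one_mul I 1 v

theorem leftTrivialization_one (v : E) : leftTrivialization (I := I) (1 : G) v = v := by
  rw [← leftDeriv_one (I := I) (G := G) v, leftTrivialization_leftDeriv, leftDeriv_one]

theorem mul_zeroSec (w : TangentBundle I G) (y : G) :
    w * zeroSec I y = ⟨w.1 * y, mfderiv I I (fun z : G => z * y) w.1 w.2⟩ := by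
  refine (tangentMul_eq _ _).trans (tangentBundle_ext rfl ?_)
  have h := map_zero (mfderiv I I (fun z : G => w.1 * z) y)
  exact (congrArg (fun t => HAdd.hAdd (α := E) (β := E) (γ := E) t _) h).trans
    (zero_add (M := E) _)

theorem mul_fiberIncl (w : TangentBundle I G) (v : E) :
    w * fiberIncl I 1 v = ⟨w.1,
      (HAdd.hAdd (α := E) (β := E) (γ := E) w.2 (leftDeriv I w.1 v) : E)⟩ := by
  refine (tangentMul_eq _ _).trans (tangentBundle_ext (mul_one _) ?_)
  have f : (fun t : G => t * 1) = id := by funext t; simp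
  have c : mfderiv I I (fun t : G => t * 1) w.1 = ContinuousLinearMap.id ℝ E := by
    rw [f]; exact mfderiv_id
  have h : (mfderiv I I (fun t : G => t * 1) w.1 w.2 : E) = w.2 := DFunLike.congr_fun c w.2
  exact (congrArg (HAdd.hAdd (α := E) (β := E) (γ := E) _) h).trans (add_comm (G := E) _ _)

theorem mk_leftDeriv (x : G) (v : E) :
    (⟨x, leftDeriv I x v⟩ : TangentBundle I G) = zeroSec I x * fiberIncl I 1 v := by
  rw [mul_fiberIncl]
  exact tangentBundle_ext rfl (zero_add (M := E) _).symm

theorem fiberIncl_leftTrivialization (x : G) (v : E) :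
    fiberIncl I 1 (leftTrivialization (I := I) x v) =
      (zeroSec I x)⁻¹ * (⟨x, v⟩ : TangentBundle I G) := by
  rw [eq_inv_mul_iff_mul_eq, ← mk_leftDeriv, leftDeriv_leftTrivialization]

theorem contMDiff_leftInvariant (v : E) :
    ContMDiff I I.tangent ∞ fun x : G => (⟨x, leftDeriv I x v⟩ : TangentBundle I G) :=
  (contMDiff_zeroSec.mul contMDiff_const).congr fun x => mk_leftDeriv x v

/-- The left trivialization `y ↦ y⁻¹ X(y)` of a vector field `X`, a function with values in
`T_e G`. -/
def leftCoord (X : (x : G) → TangentSpace I x) (x : G) : E := leftTrivialization (I := I) x (X x)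

theorem leftDeriv_leftCoord (X : (x : G) → TangentSpace I x) (x : G) :
    leftDeriv I x (leftCoord X x) = X x :=
  leftDeriv_leftTrivialization (E := E) x (X x)

theorem leftCoord_leftDeriv (σ : G → E) :
    leftCoord (I := I) (fun x => (leftDeriv I x (σ x) : E)) = σ :=
  funext fun x => leftTrivialization_leftDeriv x (σ x)

theorem leftCoord_mulInvariantVectorField (a : E) :
    leftCoord (I := I) (mulInvariantVectorField (a : GroupLieAlgebra I G)) = fun _ : G => a :=
  leftCoord_leftDeriv fun _ => a

/-- The left trivialization of a differentiable vector field is differentiable. -/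
theorem mdifferentiableAt_leftCoord {X : (x : G) → TangentSpace I x} {x : G}
    (hX : MDifferentiableAt I I.tangent (fun y => (⟨y, X y⟩ : TangentBundle I G)) x) :
    MDifferentiableAt I 𝓘(ℝ, E) (leftCoord X) x := by
  refine (mdifferentiableAt_fiber_iff (I := I) (x := (1 : G))).1 ?_
  have h1 : MDifferentiableAt I I.tangent (fun y : G => (zeroSec I y)⁻¹) x :=
    (contMDiff_zeroSec.inv).mdifferentiable (n := ∞) (by simp) x
  have h2 := MDifferentiableAt.comp x
    (mdiff_mul (I := I.tangent) ((zeroSec I x)⁻¹, (⟨x, X x⟩ : TangentBundle I G)))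
    (h1.prodMk hX)
  exact h2.congr_of_eventuallyEq (.of_forall fun y => fiberIncl_leftTrivialization (E := E) y (X y))

/-- The left trivialization of a smooth vector field is smooth. -/
theorem contMDiffAt_leftCoord {n : ℕ∞} {X : (x : G) → TangentSpace I x} {x : G}
    (hX : ContMDiffAt I I.tangent n (fun y => (⟨y, X y⟩ : TangentBundle I G)) x) :
    ContMDiffAt I 𝓘(ℝ, E) n (leftCoord X) x := by
  refine (contMDiffAt_fiber_iff (I := I) (x := (1 : G))).1 ?_
  have : LieGroup I.tangent n (TangentBundle I G) := LieGroup.of_le (n := ∞) (mod_cast le_top)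
  have h1 : ContMDiffAt I I.tangent n (fun y : G => (zeroSec I y)⁻¹) x :=
    (contMDiff_zeroSec.inv.contMDiffAt).of_le (n := ∞) (mod_cast le_top)
  exact (h1.mul hX).congr_of_eventuallyEq
    (.of_forall fun y => fiberIncl_leftTrivialization (E := E) y (X y))

/-- A vector field whose left trivialization is differentiable is differentiable. -/
theorem mdifferentiableAt_of_leftDeriv {σ : G → E} {x : G} (hσ : MDifferentiableAt I 𝓘(ℝ, E) σ x) :
    MDifferentiableAt I I.tangent (fun y => (⟨y, leftDeriv I y (σ y)⟩ : TangentBundle I G)) x := by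
  have h1 : MDifferentiableAt I I.tangent (fun y : G => zeroSec I y) x :=
    contMDiff_zeroSec.mdifferentiable (by simp) x
  have h2 : MDifferentiableAt I I.tangent (fun y : G => fiberIncl I (1 : G) (σ y)) x :=
    (mdifferentiableAt_fiber_iff (I := I) (x := (1 : G))).2 hσ
  have h3 := MDifferentiableAt.comp x
    (mdiff_mul (I := I.tangent) (zeroSec I x, (fiberIncl I (1 : G) (σ x) : TangentBundle I G)))
    (h1.prodMk h2)
  exact h3.congr_of_eventuallyEq (.of_forall fun y => mk_leftDeriv y (σ y))

/-- The left-invariant form defined by `B` takes constant values on left-invariant fields. -/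
theorem leftForm_leftDeriv (B : E →L[ℝ] E →L[ℝ] ℝ) (x : G) (u v : E) :
    leftForm (I := I) B x (leftDeriv I x u) (leftDeriv I x v) = B u v :=
  congrArg₂ (fun a b : E => B a b) (leftTrivialization_leftDeriv x u)
    (leftTrivialization_leftDeriv x v)

theorem isLeftInvariant_leftInvariantMetric [FiniteDimensional ℝ E] (B : E →L[ℝ] E →L[ℝ] ℝ)
    (hsymm : ∀ u v, B u v = B v u) (hpos : ∀ v, v ≠ 0 → 0 < B v v) :
    IsLeftInvariant (G := G) (leftInvariantMetric (I := I) B hsymm hpos) := fun a x u v =>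
  congrArg₂ (fun a b : E => B a b) (leftTrivialization_mul (E := E) a x u)
    (leftTrivialization_mul (E := E) a x v)

theorem IsLeftInvariant.inner_leftDeriv
    {g : ContMDiffRiemannianMetric I ∞ E (TangentSpace I : G → Type _)} (hg : IsLeftInvariant g)
    (x : G) (u v : E) :
    g.inner x (leftDeriv I x u) (leftDeriv I x v) = g.inner 1 u v := by
  have h : ∀ y : G, y = x * 1 → g.inner y (leftDeriv I x u) (leftDeriv I x v) = g.inner 1 u v := by
    rintro _ rfl
    exact hg x 1 u v
  exact h x (mul_one x).symm

end Translation

/-! ### Left-invariant connections -/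

section Differential

variable {E : Type*} [NormedAddCommGroup E] [NormedSpace ℝ E]
  {H : Type*} [TopologicalSpace H] {I : ModelWithCorners ℝ E H}
  {M : Type*} [TopologicalSpace M] [ChartedSpace H M]
  {F : Type*} [NormedAddCommGroup F] [NormedSpace ℝ F]

variable (I) in
/-- The differential at `x` of a vector-valued function, the tangent space at `x` being identified
with the model space. -/
def differential (f : M → F) (x : M) : E →L[ℝ] F := mfderiv I 𝓘(ℝ, F) f x

theorem dirDeriv_eq_differential (f : M → F) (X : (x : M) → TangentSpace I x) (x : M) :
    dirDeriv f X x = differential I f x (X x) := rfl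

theorem differential_congr {f f' : M → F} {x : M} (h : f =ᶠ[𝓝 x] f') :
    differential I f x = differential I f' x := h.mfderiv_eq

theorem differential_const (c : F) (x : M) : differential I (fun _ : M => c) x = 0 :=
  mfderiv_const

theorem differential_add {f f' : M → F} {x : M} (hf : MDifferentiableAt I 𝓘(ℝ, F) f x)
    (hf' : MDifferentiableAt I 𝓘(ℝ, F) f' x) :
    differential I (f + f') x = differential I f x + differential I f' x :=
  (mvfderiv_add hf hf' :)

theorem differential_smul {f : M → ℝ} {f' : M → F} {x : M} (hf : MDifferentiableAt I 𝓘(ℝ, ℝ) f x)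
    (hf' : MDifferentiableAt I 𝓘(ℝ, F) f' x) (u : E) :
    differential I (f • f') x u = f x • differential I f' x u + differential I f x u • f' x :=
  DFunLike.congr_fun (mvfderiv_smul hf hf') u

theorem hasMFDerivAt_bilin {F' F'' : Type*} [NormedAddCommGroup F'] [NormedSpace ℝ F']
    [NormedAddCommGroup F''] [NormedSpace ℝ F''] (B : F →L[ℝ] F' →L[ℝ] F'')
    {f : M → F} {f' : M → F'} {x : M} (hf : MDifferentiableAt I 𝓘(ℝ, F) f x)
    (hf' : MDifferentiableAt I 𝓘(ℝ, F') f' x) :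
    HasMFDerivAt I 𝓘(ℝ, F'') (fun y => B (f y) (f' y)) x
      ((B (f x)).comp (differential I f' x) + (B.flip (f' x)).comp (differential I f x)) := by
  have h1 : HasMFDerivAt I 𝓘(ℝ, F × F') (fun y => (f y, f' y)) x
      ((differential I f x).prod (differential I f' x)) := by
    have h := hf.hasMFDerivAt.prodMk hf'.hasMFDerivAt
    rw [← modelWithCornersSelf_prod, chartedSpaceSelf_prod] at h
    exact h
  have h2 := (B.isBoundedBilinearMap.hasFDerivAt (f x, f' x)).hasMFDerivAt
  exact h2.comp x h1

theorem differential_bilin {F' F'' : Type*} [NormedAddCommGroup F'] [NormedSpace ℝ F']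
    [NormedAddCommGroup F''] [NormedSpace ℝ F''] (B : F →L[ℝ] F' →L[ℝ] F'')
    {f : M → F} {f' : M → F'} {x : M} (hf : MDifferentiableAt I 𝓘(ℝ, F) f x)
    (hf' : MDifferentiableAt I 𝓘(ℝ, F') f' x)
    (u : E) :
    differential I (fun y => B (f y) (f' y)) x u =
      B (f x) (differential I f' x u) + B (differential I f x u) (f' x) :=
  DFunLike.congr_fun (hasMFDerivAt_bilin B hf hf').mfderiv u

end Differential

section Connection

variable {E : Type*} [NormedAddCommGroup E] [NormedSpace ℝ E]
  {H : Type*} [TopologicalSpace H] {I : ModelWithCorners ℝ E H}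
  {G : Type*} [TopologicalSpace G] [ChartedSpace H G] [Group G] [LieGroup I ∞ G]

/-- The connection on `G` which is `d + Γ` in the left trivialization: if `X` and `Y` are the
left-invariant vector fields with values `a` and `b` at the identity, then `∇_X Y` is the
left-invariant vector field with value `Γ a b`. -/
def leftConnectionFun (Γ : E →L[ℝ] E →L[ℝ] E) (Y : (x : G) → TangentSpace I x) (x : G) :
    E →L[ℝ] E :=
  (leftDeriv I x).comp (differential I (leftCoord Y) x +
    (Γ.flip (leftCoord Y x)).comp (leftTrivialization (I := I) x))

omit [LieGroup I ∞ G] in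
theorem leftConnectionFun_apply (Γ : E →L[ℝ] E →L[ℝ] E) (Y : (x : G) → TangentSpace I x) (x : G)
    (u : E) : leftConnectionFun Γ Y x u = leftDeriv I x (differential I (leftCoord Y) x u +
      Γ (leftTrivialization (I := I) x u) (leftCoord Y x)) := rfl

/-- The connection on `G` which is `d + Γ` in the left trivialization. -/
def leftConnection (Γ : E →L[ℝ] E →L[ℝ] E) :
    CovariantDerivative I E (TangentSpace I : G → Type _) where
  toFun := leftConnectionFun Γ
  isCovariantDerivativeOnUniv :=
    { add := by
        intro Y Z x hY hZ _
        have hY' := mdifferentiableAt_leftCoord hY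
        have hZ' := mdifferentiableAt_leftCoord hZ
        have h1 : leftCoord (Y + Z) = leftCoord Y + leftCoord Z :=
          funext fun y => map_add (leftTrivialization (I := I) y) (Y y : E) (Z y)
        refine ContinuousLinearMap.ext (M₁ := E) fun u => ?_
        change (_ : E) = (leftConnectionFun Γ Y x u + leftConnectionFun Γ Z x u : E)
        rw [leftConnectionFun_apply, leftConnectionFun_apply, leftConnectionFun_apply, h1,
          differential_add hY' hZ']
        simp only [Pi.add_apply, map_add, add_apply]
        abel
      leibniz := by
        intro Y f x hY hf _
        have hY' := mdifferentiableAt_leftCoord hY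
        have h1 : leftCoord (f • Y) = f • leftCoord Y :=
          funext fun y => map_smul (leftTrivialization (I := I) y) (f y) (Y y : E)
        refine ContinuousLinearMap.ext (M₁ := E) fun u => ?_
        refine Eq.trans (?_ : _ = f x • leftConnectionFun Γ Y x u +
          HSMul.hSMul (α := ℝ) (β := E) (γ := E) (differential I f x u) (Y x)) rfl
        rw [leftConnectionFun_apply, leftConnectionFun_apply, h1, differential_smul hf hY',
          ← leftDeriv_leftCoord Y x]
        simp only [Pi.smul_apply', map_add, map_smul, smul_add]
        abel }

theorem leftConnection_apply (Γ : E →L[ℝ] E →L[ℝ] E) (Y : (x : G) → TangentSpace I x) (x : G)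
    (u : E) : (leftConnection Γ Y x u : E) =
      leftDeriv I x (differential I (leftCoord Y) x u +
        Γ (leftTrivialization (I := I) x u) (leftCoord Y x)) := rfl

open VectorField

variable (I G) in
/-- The Lie bracket of `T_e G`, as an operation on the model space. -/
def lieBr (a b : E) : E := Bracket.bracket (L := GroupLieAlgebra I G) (M := GroupLieAlgebra I G) a b

/-- Left-invariant fields are closed under the bracket, which is `lieBr` at the identity. -/
theorem mlieBracket_mulInvariantVectorField [CompleteSpace E] (a b : E) (x : G) :
    (mlieBracket I (mulInvariantVectorField (a : GroupLieAlgebra I G))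
      (mulInvariantVectorField (b : GroupLieAlgebra I G)) x : E) =
      leftDeriv I x (lieBr I G a b) := by
  have : LieGroup I (minSmoothness ℝ 3) G := by
    rw [minSmoothness_of_isRCLikeNormedField]
    exact LieGroup.of_le (n := ∞) (by norm_cast)
  exact (congrFun (mulInvariantVector_mlieBracket (I := I) a b) x).symm

variable [FiniteDimensional ℝ E]

theorem torsion_leftConnection {Γ : E →L[ℝ] E →L[ℝ] E}
    (hΓ : ∀ a b, Γ a b - Γ b a = lieBr I G a b) :
    (leftConnection Γ : CovariantDerivative I E (TangentSpace I : G → Type _)).torsion = 0 := by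
  set D : CovariantDerivative I E (TangentSpace I : G → Type _) := leftConnection Γ with hD
  funext x
  refine ContinuousLinearMap.ext (M₁ := E) fun u => ContinuousLinearMap.ext (M₁ := E) fun v => ?_
  obtain ⟨a, rfl⟩ : ∃ a, leftDeriv I x a = u := ⟨_, leftDeriv_leftTrivialization x u⟩
  obtain ⟨b, rfl⟩ : ∃ b, leftDeriv I x b = v := ⟨_, leftDeriv_leftTrivialization x v⟩
  have hd : ∀ a : GroupLieAlgebra I G, MDifferentiableAt I I.tangent
      (fun y : G => (⟨y, mulInvariantVectorField a y⟩ : TangentBundle I G)) x :=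
    fun a => (contMDiff_leftInvariant (I := I) (G := G) a).mdifferentiable (by simp) x
  have hc : ∀ a b : E, (D (mulInvariantVectorField (b : GroupLieAlgebra I G)) x
      (mulInvariantVectorField (a : GroupLieAlgebra I G) x) : E) = leftDeriv I x (Γ a b) := by
    intro a b
    refine (leftConnection_apply Γ _ x (leftDeriv I x a)).trans ?_
    rw [leftCoord_mulInvariantVectorField, differential_const, leftTrivialization_leftDeriv]
    exact congrArg (leftDeriv I x) (zero_add _)
  refine (D.torsion_apply (hd a) (hd b)).trans ?_
  refine Eq.trans (congrArg₂ (HSub.hSub (α := E) (β := E) (γ := E))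
    (congrArg₂ (HSub.hSub (α := E) (β := E) (γ := E)) (hc a b) (hc b a))
    (mlieBracket_mulInvariantVectorField a b x)) ?_
  rw [← map_sub, hΓ]
  exact sub_self (G := E) _

/-- Koszul's conditions on the Lie algebra: `d + Γ` is the Levi-Civita connection when the
commutator of `Γ` is the Lie bracket and the operators `Γ a` are skew-adjoint. -/
theorem isLeviCivita_leftConnection
    {g : ContMDiffRiemannianMetric I ∞ E (TangentSpace I : G → Type _)} (hg : IsLeftInvariant g)
    {Γ : E →L[ℝ] E →L[ℝ] E} (hΓ : ∀ a b, Γ a b - Γ b a = lieBr I G a b)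
    (hB : ∀ a b c : E, g.inner 1 (Γ a b) c + g.inner 1 b (Γ a c) = 0) :
    IsLeviCivita g (leftConnection Γ) where
  torsion_eq_zero := torsion_leftConnection hΓ
  metric_compatible := by
    intro Y Z x (u : E) hY hZ
    let B : E →L[ℝ] E →L[ℝ] ℝ := g.inner 1
    have h1 : (fun y => g.inner y (Y y) (Z y)) = fun y => B (leftCoord Y y) (leftCoord Z y) := by
      funext y
      refine Eq.trans ?_ (hg.inner_leftDeriv y (leftCoord Y y) (leftCoord Z y))
      exact congrArg₂ (fun a b : E => g.inner y a b) (leftDeriv_leftCoord Y y).symm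
        (leftDeriv_leftCoord Z y).symm
    have h2 : ∀ (Y Z : (x : G) → TangentSpace I x),
        g.inner x (leftConnection Γ Y x u) (Z x) = B (differential I (leftCoord Y) x u +
          Γ (leftTrivialization (I := I) x u) (leftCoord Y x)) (leftCoord Z x) := fun Y Z =>
      (congrArg (fun b : E => g.inner x (leftConnection Γ Y x u) b)
        (leftDeriv_leftCoord Z x).symm).trans
        (hg.inner_leftDeriv x _ _)
    rw [g.symm x (Y x), h2 Y Z, h2 Z Y]
    refine Eq.trans (?_ : _ = differential I (fun y => g.inner y (Y y) (Z y)) x u) ?_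
    · rfl
    rw [h1, differential_bilin B (mdifferentiableAt_leftCoord hY)
      (mdifferentiableAt_leftCoord hZ), map_add, map_add, add_apply, add_apply]
    have hs : ∀ a b, B a b = B b a := g.symm 1
    have h3 : B (Γ (leftTrivialization (I := I) x u) (leftCoord Y x)) (leftCoord Z x) +
        B (leftCoord Y x) (Γ (leftTrivialization (I := I) x u) (leftCoord Z x)) = 0 := hB _ _ _
    rw [hs (differential I (leftCoord Z) x u), hs (Γ _ (leftCoord Z x))]
    linarith

end Connection

/-! ### Curvature of left-invariant metrics -/

section Uniqueness

variable {E : Type*} [NormedAddCommGroup E] [NormedSpace ℝ E] [FiniteDimensional ℝ E]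
  {H : Type*} [TopologicalSpace H] {I : ModelWithCorners ℝ E H}
  {M : Type*} [TopologicalSpace M] [ChartedSpace H M] [IsManifold I ∞ M]

/-- A trilinear expression which is symmetric in the first two arguments and skew-symmetric in the
outer ones vanishes; applied to the difference of two Levi-Civita connections, this gives their
equality on differentiable vector fields. -/
theorem IsLeviCivita.eq {g : ContMDiffRiemannianMetric I ∞ E (TangentSpace I : M → Type _)}
    {D D' : CovariantDerivative I E (TangentSpace I : M → Type _)} (hD : IsLeviCivita g D)
    (hD' : IsLeviCivita g D') {Y : (x : M) → TangentSpace I x} {x : M}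
    (hY : MDifferentiableAt I I.tangent (fun y => (⟨y, Y y⟩ : TangentBundle I M)) x) :
    D Y x = D' Y x := by
  let A := D.isCovariantDerivativeOnUniv.difference D'.isCovariantDerivativeOnUniv x
  let ext (v : TangentSpace I x) : (y : M) → TangentSpace I y := FiberBundle.extend E v
  have hext : ∀ v, MDifferentiableAt I I.tangent
      (fun y => (⟨y, ext v y⟩ : TangentBundle I M)) x := fun v =>
    FiberBundle.mdifferentiableAt_extend I E v
  have hx : ∀ v, ext v x = v := fun v => FiberBundle.extend_apply_self E v
  have hA : ∀ {Z : (x : M) → TangentSpace I x},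
      MDifferentiableAt I I.tangent (fun y => (⟨y, Z y⟩ : TangentBundle I M)) x →
      A (Z x) = D Z x - D' Z x := fun hZ =>
    IsCovariantDerivativeOn.difference_apply D.isCovariantDerivativeOnUniv
      D'.isCovariantDerivativeOnUniv trivial hZ
  have hA' : ∀ v u, A v u = D (ext v) x u - D' (ext v) x u := fun v u => by
    conv_lhs => rw [← hx v]
    exact DFunLike.congr_fun (hA (hext v)) u
  have symm : ∀ v u, A v u = A u v := fun v u => by
    have h1 := D.torsion_eq_zero_iff.1 hD.torsion_eq_zero (hext u) (hext v)
    have h2 := D'.torsion_eq_zero_iff.1 hD'.torsion_eq_zero (hext u) (hext v)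
    rw [hx, hx] at h1 h2
    rw [hA', hA', ← sub_eq_zero, ← sub_eq_zero.2 (h1.trans h2.symm)]
    abel
  have skew : ∀ v u w, g.inner x (A v u) w + g.inner x v (A w u) = 0 := fun v u w => by
    have h1 := hD.metric_compatible (ext v) (ext w) x u (hext v) (hext w)
    have h2 := hD'.metric_compatible (ext v) (ext w) x u (hext v) (hext w)
    have h3 := h1.symm.trans h2
    rw [hx, hx] at h3
    rw [hA', hA', map_sub, map_sub, sub_apply]
    linear_combination h3
  have zero : ∀ v u, A v u = 0 := fun v u => by
    have f0 : ∀ w, g.inner x (A v u) w = 0 := fun w => by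
      have e1 := skew v u w
      have e2 := skew u w v
      have e3 := skew w v u
      rw [g.symm x v] at e1
      rw [g.symm x u] at e2
      rw [g.symm x w] at e3
      rw [symm u w, symm v w] at e2
      rw [symm w v, symm u v] at e3
      rw [symm w u] at e1
      rw [symm w u] at e2
      rw [symm v w] at e3
      linarith
    by_contra h
    exact (g.pos x _ h).ne' (f0 _)
  ext u
  have h := DFunLike.congr_fun (hA hY) u
  rw [zero] at h
  exact (sub_eq_zero.1 h.symm)

end Uniqueness

section Curvature

variable {E : Type*} [NormedAddCommGroup E] [NormedSpace ℝ E]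
  {H : Type*} [TopologicalSpace H] {I : ModelWithCorners ℝ E H}
  {G : Type*} [TopologicalSpace G] [ChartedSpace H G] [Group G] [LieGroup I ∞ G]

/-- The curvature `Γ_a Γ_b c - Γ_b Γ_a c - Γ_[a, b] c` of the bilinear product `Γ`, the bracket
`[a, b]` being the commutator of `Γ`. -/
def algCurvature (Γ : E →L[ℝ] E →L[ℝ] E) (a b c : E) : E :=
  Γ a (Γ b c) - Γ b (Γ a c) - Γ (Γ a b - Γ b a) c

variable [FiniteDimensional ℝ E]

/-- The second covariant derivative `∇_u (∇_Y Z)` in the left trivialization: with `∇ = d + Γ` and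
`σ = Y(Z) + Γ(Y, Z)` it is `u(σ) + Γ(u, σ)`, where `u(Γ(Y, Z))` is expanded by the product rule. -/
theorem leviCivita_leviCivita_apply
    {g : ContMDiffRiemannianMetric I ∞ E (TangentSpace I : G → Type _)} {Γ : E →L[ℝ] E →L[ℝ] E}
    (hΓ : IsLeviCivita g (leftConnection Γ))
    {D : CovariantDerivative I E (TangentSpace I : G → Type _)} (hD : IsLeviCivita g D)
    {Y Z : (x : G) → TangentSpace I x} {x : G}
    (hY : ContMDiffAt I I.tangent 2 (fun y => (⟨y, Y y⟩ : TangentBundle I G)) x)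
    (hZ : ContMDiffAt I I.tangent 2 (fun y => (⟨y, Z y⟩ : TangentBundle I G)) x) (u : E) :
    (D (fun y => D Z y (Y y)) x u : E) = leftDeriv I x
      (differential I (dirDeriv (leftCoord Z) Y) x u +
        (Γ (leftCoord Y x) (differential I (leftCoord Z) x u) +
          Γ (differential I (leftCoord Y) x u) (leftCoord Z x)) +
        Γ (leftTrivialization (I := I) x u)
          (dirDeriv (leftCoord Z) Y x + Γ (leftCoord Y x) (leftCoord Z x))) := by
  let σ : G → E := dirDeriv (leftCoord Z) Y + fun y => Γ (leftCoord Y y) (leftCoord Z y)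
  have hcY : MDifferentiableAt I 𝓘(ℝ, E) (leftCoord Y) x :=
    mdifferentiableAt_leftCoord (hY.mdifferentiableAt (by simp))
  have hcZ : MDifferentiableAt I 𝓘(ℝ, E) (leftCoord Z) x :=
    mdifferentiableAt_leftCoord (hZ.mdifferentiableAt (by simp))
  have hdZ : MDifferentiableAt I 𝓘(ℝ, E) (dirDeriv (leftCoord Z) Y) x :=
    (contMDiffAt_dirDeriv (n := 1) (contMDiffAt_leftCoord (n := 2) hZ)
      (hY.of_le (by norm_cast))).mdifferentiableAt (by simp)
  have hbil := hasMFDerivAt_bilin Γ hcY hcZ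
  have hσ : MDifferentiableAt I 𝓘(ℝ, E) σ x := hdZ.add hbil.mdifferentiableAt
  have ev : ∀ᶠ y in 𝓝 x, (D Z y (Y y) : E) = leftDeriv I y (σ y) := by
    filter_upwards [(contMDiffAt_iff_contMDiffAt_nhds (by simp)).1 hZ] with y hy
    refine (DFunLike.congr_fun (hD.eq hΓ (hy.mdifferentiableAt (by simp))) (Y y)).trans ?_
    rfl
  have hs : MDifferentiableAt I I.tangent
      (fun y => (⟨y, D Z y (Y y)⟩ : TangentBundle I G)) x :=
    (mdifferentiableAt_of_leftDeriv hσ).congr_of_eventuallyEq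
      (ev.mono fun y hy => tangentBundle_ext rfl hy)
  have hc : leftCoord (fun y => D Z y (Y y)) =ᶠ[𝓝 x] σ :=
    ev.mono fun y hy => (congrArg (leftTrivialization (I := I) y) hy).trans
      (leftTrivialization_leftDeriv y (σ y))
  refine (DFunLike.congr_fun (hD.eq hΓ hs) u).trans ?_
  refine (leftConnection_apply Γ _ x u).trans ?_
  rw [differential_congr hc, hc.eq_of_nhds, differential_add hdZ hbil.mdifferentiableAt]
  rw [add_apply, differential_bilin Γ hcY hcZ]
  rfl

open VectorField

/-- The curvature tensor of a left-invariant metric on left-invariant vectors, in terms of the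
Levi-Civita product `Γ` on the Lie algebra. The second derivatives cancel since `[X, Y]` acts on
functions as the commutator of `X` and `Y`. -/
theorem curvature_leftDeriv
    {g : ContMDiffRiemannianMetric I ∞ E (TangentSpace I : G → Type _)} {Γ : E →L[ℝ] E →L[ℝ] E}
    (hΓ : IsLeviCivita g (leftConnection Γ))
    {D : CovariantDerivative I E (TangentSpace I : G → Type _)} (hD : IsLeviCivita g D)
    (x : G) (a b c : E) :
    (curvature D x (leftDeriv I x a) (leftDeriv I x b) (leftDeriv I x c) : E) =
      leftDeriv I x (algCurvature Γ a b c) := by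
  let X : (y : G) → TangentSpace I y := FiberBundle.extend E (x := x) (leftDeriv I x a)
  let Y : (y : G) → TangentSpace I y := FiberBundle.extend E (x := x) (leftDeriv I x b)
  let Z : (y : G) → TangentSpace I y := FiberBundle.extend E (x := x) (leftDeriv I x c)
  have hX : ContMDiffAt I I.tangent 2 (fun y => (⟨y, X y⟩ : TangentBundle I G)) x :=
    FiberBundle.contMDiffAt_extend I E _
  have hY : ContMDiffAt I I.tangent 2 (fun y => (⟨y, Y y⟩ : TangentBundle I G)) x :=
    FiberBundle.contMDiffAt_extend I E _
  have hZ : ContMDiffAt I I.tangent 2 (fun y => (⟨y, Z y⟩ : TangentBundle I G)) x :=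
    FiberBundle.contMDiffAt_extend I E _
  have hX1 := hX.mdifferentiableAt (by simp)
  have hY1 := hY.mdifferentiableAt (by simp)
  have hZ1 := hZ.mdifferentiableAt (by simp)
  have cX : leftCoord X x = a := by
    refine (congrArg (leftTrivialization (I := I) x) ?_).trans (leftTrivialization_leftDeriv x a)
    exact FiberBundle.extend_apply_self E (E := (TangentSpace I : G → Type _)) (x := x)
      (leftDeriv I x a)
  have cY : leftCoord Y x = b := by
    refine (congrArg (leftTrivialization (I := I) x) ?_).trans (leftTrivialization_leftDeriv x b)
    exact FiberBundle.extend_apply_self E (E := (TangentSpace I : G → Type _)) (x := x)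
      (leftDeriv I x b)
  have cZ : leftCoord Z x = c := by
    refine (congrArg (leftTrivialization (I := I) x) ?_).trans (leftTrivialization_leftDeriv x c)
    exact FiberBundle.extend_apply_self E (E := (TangentSpace I : G → Type _)) (x := x)
      (leftDeriv I x c)
  have e1 := leviCivita_leviCivita_apply hΓ hD hY hZ (X x)
  have e2 := leviCivita_leviCivita_apply hΓ hD hX hZ (Y x)
  have e3 : (D Z x (mlieBracket I X Y x) : E) = leftDeriv I x
      (dirDeriv (leftCoord Z) (mlieBracket I X Y) x + Γ (leftCoord (mlieBracket I X Y) x)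
        (leftCoord Z x)) :=
    (DFunLike.congr_fun (hD.eq hΓ hZ1) _).trans (leftConnection_apply Γ _ x _)
  have e4 : leftCoord (mlieBracket I X Y) x =
      differential I (leftCoord Y) x (X x) + Γ (leftCoord X x) (leftCoord Y x) -
        (differential I (leftCoord X) x (Y x) + Γ (leftCoord Y x) (leftCoord X x)) := by
    have h := (leftConnection Γ : CovariantDerivative I E
      (TangentSpace I : G → Type _)).torsion_eq_zero_iff.1 hΓ.torsion_eq_zero hX1 hY1
    have h' : (mlieBracket I X Y x : E) = leftDeriv I x
      (differential I (leftCoord Y) x (X x) + Γ (leftCoord X x) (leftCoord Y x) -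
        (differential I (leftCoord X) x (Y x) + Γ (leftCoord Y x) (leftCoord X x))) :=
      h.symm.trans (map_sub (leftDeriv I x) _ _).symm
    exact (congrArg (leftTrivialization (I := I) x) h').trans (leftTrivialization_leftDeriv x _)
  rw [dirDeriv_mlieBracket (contMDiffAt_leftCoord (n := 2) hZ) hX hY, e4] at e3
  refine Eq.trans (congrArg₂ (HSub.hSub (α := E) (β := E) (γ := E))
    (congrArg₂ (HSub.hSub (α := E) (β := E) (γ := E)) e1 e2) e3) ?_
  rw [← map_sub, ← map_sub]
  have t1 : leftTrivialization (I := I) x (X x) = a := cX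
  have t2 : leftTrivialization (I := I) x (Y x) = b := cY
  rw [t1, t2, cX, cY, cZ]
  congr 1
  simp only [dirDeriv_eq_differential, algCurvature, map_add, map_sub, add_apply, sub_apply]
  abel

/-- The sectional curvature of a left-invariant metric, in terms of the Levi-Civita product `Γ` on
the Lie algebra. -/
theorem sectionalCurvature_leftDeriv
    {g : ContMDiffRiemannianMetric I ∞ E (TangentSpace I : G → Type _)} (hg : IsLeftInvariant g)
    {B : E →L[ℝ] E →L[ℝ] ℝ} (hgB : ∀ a b : E, g.inner 1 a b = B a b)
    {Γ : E →L[ℝ] E →L[ℝ] E} (hΓ : ∀ a b, Γ a b - Γ b a = lieBr I G a b)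
    (hB : ∀ a b c, B (Γ a b) c + B b (Γ a c) = 0) (x : G) (a b : E) :
    sectionalCurvature g x (leftDeriv I x a) (leftDeriv I x b) =
      B (algCurvature Γ a b b) a / (B a a * B b b - B a b ^ 2) := by
  have h := isLeviCivita_leftConnection hg hΓ (fun a b c => by
    have := hB a b c
    rwa [← hgB, ← hgB] at this)
  have hex : ∃ D : CovariantDerivative I E (TangentSpace I : G → Type _), IsLeviCivita g D := ⟨_, h⟩
  have e := curvature_leftDeriv h hex.choose_spec x a b b
  have hi : ∀ a b : E, g.inner x (leftDeriv I x a) (leftDeriv I x b) = B a b := fun a b =>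
    (hg.inner_leftDeriv x a b).trans (hgB a b)
  refine (dif_pos hex).trans (congrArg₂ (· / ·) ?_ ?_)
  · exact (congrArg (fun t : E => g.inner x t (leftDeriv I x a)) e).trans (hi _ _)
  · exact congrArg₂ (· - ·) (congrArg₂ (· * ·) (hi _ _) (hi _ _)) (congrArg (· ^ 2) (hi _ _))

end Curvature

/-! ### The Lie algebra of the tangent group -/

section LeftDer

variable {E : Type*} [NormedAddCommGroup E] [NormedSpace ℝ E]
  {H : Type*} [TopologicalSpace H] {I : ModelWithCorners ℝ E H}
  {G : Type*} [TopologicalSpace G] [ChartedSpace H G] [Group G] [LieGroup I ∞ G]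
  {F : Type*} [NormedAddCommGroup F] [NormedSpace ℝ F]

variable (I) in
/-- The derivative of a function on `G` along the left-invariant vector field with value `a` at the
identity. -/
def leftDer (a : E) (f : G → F) (x : G) : F := differential I f x (leftDeriv I x a)

theorem contMDiff_leftDer (a : E) {f : G → F} (hf : ContMDiff I 𝓘(ℝ, F) ∞ f) :
    ContMDiff I 𝓘(ℝ, F) ∞ (leftDer I a f) :=
  contMDiff_dirDeriv hf (contMDiff_leftInvariant a)

omit [LieGroup I ∞ G] in
theorem leftDer_add_fun (a : E) {f f' : G → F} (hf : ContMDiff I 𝓘(ℝ, F) ∞ f)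
    (hf' : ContMDiff I 𝓘(ℝ, F) ∞ f') : leftDer I a (f + f') = leftDer I a f + leftDer I a f' := by
  funext x
  unfold leftDer
  rw [differential_add (hf.mdifferentiable (by simp) x) (hf'.mdifferentiable (by simp) x)]
  rfl

omit [LieGroup I ∞ G] in
theorem leftDer_one (a : E) (f : G → F) : leftDer I a f 1 = differential I f 1 a := by
  unfold leftDer
  rw [leftDeriv_one]

/-- The chain rule for the composition of a function with a left translation. -/
theorem leftDer_eq_differential_mul (a : E) {f : G → F} (hf : ContMDiff I 𝓘(ℝ, F) ∞ f) (x : G) :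
    leftDer I a f x = differential I (fun y => f (x * y)) 1 a := by
  have h := mfderiv_comp (I' := I) (1 : G) (hf.mdifferentiable (by simp) (x * 1))
    (mdiff_left (I := I) x 1)
  refine Eq.trans ?_ (DFunLike.congr_fun h a).symm
  have hx : ∀ y, y = x → differential I f x (leftDeriv I x a) =
      differential I f y (leftDeriv I x a) := by
    rintro _ rfl
    rfl
  exact hx _ (mul_one x)

/-- The bracket of the Lie algebra is the commutator of the left-invariant derivations. -/
theorem leftDer_lieBr [CompleteSpace E] (a b : E) {f : G → F} (hf : ContMDiff I 𝓘(ℝ, F) ∞ f)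
    (x : G) :
    leftDer I (lieBr I G a b) f x =
      leftDer I a (leftDer I b f) x - leftDer I b (leftDer I a f) x := by
  have h2 : (2 : ℕ∞ω) ≤ ∞ := by norm_cast
  have h := dirDeriv_mlieBracket ((hf x).of_le h2)
    (((contMDiff_leftInvariant (I := I) a) x).of_le h2)
    (((contMDiff_leftInvariant (I := I) b) x).of_le h2)
  refine Eq.trans ?_ h
  exact congrArg (fun t : E => differential I f x t)
    (mlieBracket_mulInvariantVectorField a b x).symm

/-- Smooth functions separate tangent vectors. -/
theorem eq_of_forall_differential_eq {M : Type*} [TopologicalSpace M] [ChartedSpace H M]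
    [IsManifold I ∞ M] [FiniteDimensional ℝ E] [T2Space M] {x : M} {u v : E}
    (h : ∀ f : M → E, ContMDiff I 𝓘(ℝ, E) ∞ f → differential I f x u = differential I f x v) :
    u = v := by
  let ρ : SmoothBumpFunction I x := Classical.arbitrary _
  have hs : ContMDiffOn I 𝓘(ℝ, E) ∞ (extChartAt I x) (chartAt H x).source := contMDiffOn_extChartAt
  have h1 := h _ (ρ.contMDiff_smul hs)
  have ev : (fun y => ρ y • extChartAt I x y) =ᶠ[𝓝 x] extChartAt I x := by
    filter_upwards [ρ.eventuallyEq_one] with y hy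
    simp [hy]
  rw [differential_congr ev] at h1
  exact (isInvertible_mfderiv_extChartAt (mem_extChartAt_source (I := I) x)).injective h1

end LeftDer

section TangentBracket

variable {E : Type*} [NormedAddCommGroup E] [NormedSpace ℝ E]
  {H : Type*} [TopologicalSpace H] {I : ModelWithCorners ℝ E H}
  {G : Type*} [TopologicalSpace G] [ChartedSpace H G] [Group G] [LieGroup I ∞ G]
  {F : Type*} [NormedAddCommGroup F] [NormedSpace ℝ F]

/-- The left-invariant derivation of `TG` with value `(a, 0)` at the identity differentiates along
right translation by the zero section. -/
theorem leftDer_tangent_horizontal {f : TangentBundle I G → F}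
    (hf : ContMDiff I.tangent 𝓘(ℝ, F) ∞ f) (w : TangentBundle I G) (a : E) :
    leftDer I.tangent (a, (0 : E)) f w = differential I (fun y : G => f (w * zeroSec I y)) 1 a := by
  rw [leftDer_eq_differential_mul _ hf]
  have h := mfderiv_comp (I' := I.tangent) (1 : G) (f := zeroSec I) (g := fun y => f (w * y))
    ((hf.comp (contMDiff_const.mul contMDiff_id)).mdifferentiable (by simp) (zeroSec I 1))
    (contMDiff_zeroSec.mdifferentiable (by simp) 1)
  refine Eq.trans ?_ (DFunLike.congr_fun h a).symm
  exact congrArg (fun t : E × E => differential I.tangent (fun y => f (w * y))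
    (zeroSec I (1 : G)) t) (mfderiv_zeroSec (I := I) (1 : G) a).symm

/-- The left-invariant derivation of `TG` with value `(0, b)` at the identity differentiates along
right translation by `T_e G`. -/
theorem leftDer_tangent_vertical {f : TangentBundle I G → F}
    (hf : ContMDiff I.tangent 𝓘(ℝ, F) ∞ f) (w : TangentBundle I G) (b : E) :
    leftDer I.tangent ((0 : E), b) f w =
      differential 𝓘(ℝ, E) (fun t : E => f (w * fiberIncl I 1 t)) 0 b := by
  rw [leftDer_eq_differential_mul _ hf]
  have h := mfderiv_comp (I' := I.tangent) (0 : E) (f := fiberIncl I (1 : G))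
    (g := fun y => f (w * y))
    ((hf.comp (contMDiff_const.mul contMDiff_id)).mdifferentiable (by simp) (fiberIncl I 1 0))
    ((contMDiff_fiberIncl (1 : G)).mdifferentiable (by simp) 0)
  refine Eq.trans ?_ (DFunLike.congr_fun h b).symm
  exact congrArg (fun t : E × E => differential I.tangent (fun y => f (w * y))
    (fiberIncl I (1 : G) 0) t) (mfderiv_fiberIncl (I := I) (1 : G) b).symm

theorem leftDer_tangent_split (f : TangentBundle I G → F) (w : TangentBundle I G) (v : E × E) :
    leftDer I.tangent v f w =
      leftDer I.tangent (v.1, (0 : E)) f w + leftDer I.tangent ((0 : E), v.2) f w := by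
  unfold leftDer
  rw [← map_add, ← map_add]
  simp

variable (I) in
/-- The fibrewise linear function on the tangent bundle defined by the differential of `f`. -/
def tdiff (f : G → F) (w : TangentBundle I G) : F := differential I f w.1 w.2

theorem contMDiff_tdiff {f : G → F} (hf : ContMDiff I 𝓘(ℝ, F) ∞ f) :
    ContMDiff I.tangent 𝓘(ℝ, F) ∞ (tdiff I f) :=
  (contMDiff_snd_tangentBundle_modelSpace F 𝓘(ℝ, F)).comp (hf.contMDiff_tangentMap le_rfl)

theorem contMDiff_comp_proj {f : G → F} (hf : ContMDiff I 𝓘(ℝ, F) ∞ f) :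
    ContMDiff I.tangent 𝓘(ℝ, F) ∞ (fun w : TangentBundle I G => f w.1) :=
  hf.comp (contMDiff_proj _)

theorem leftDer_comp_proj {f : G → F} (hf : ContMDiff I 𝓘(ℝ, F) ∞ f) (v : E × E) :
    leftDer I.tangent v (fun w : TangentBundle I G => f w.1) = fun w => leftDer I v.1 f w.1 := by
  funext w
  rw [leftDer_tangent_split, leftDer_tangent_horizontal (contMDiff_comp_proj hf),
    leftDer_tangent_vertical (contMDiff_comp_proj hf)]
  have h2 : (fun t : E => f (w * fiberIncl I 1 t).1) = fun _ => f w.1 := by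
    funext t
    rw [mul_fiberIncl]
  have h1 : (fun y : G => f (w * zeroSec I y).1) = fun y => f (w.1 * y) := by
    funext y
    rw [mul_zeroSec]
  rw [h2, differential_const, h1, leftDer_eq_differential_mul _ hf]
  exact add_zero _

/-- The left-invariant derivation of `TG` with value `(a, b)` maps `df` to `d(a f) + (b f) ∘ π`. The
term `d(a f)` comes from the symmetry of the mixed second derivatives of `(x, y) ↦ f (x y)`. -/
theorem leftDer_tdiff [I.Boundaryless] {f : G → F} (hf : ContMDiff I 𝓘(ℝ, F) ∞ f) (v : E × E) :
    leftDer I.tangent v (tdiff I f) =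
      tdiff I (leftDer I v.1 f) + fun w => leftDer I v.2 f w.1 := by
  funext w
  rw [leftDer_tangent_split, leftDer_tangent_horizontal (contMDiff_tdiff hf),
    leftDer_tangent_vertical (contMDiff_tdiff hf)]
  refine congrArg₂ (· + ·) ?_ ?_
  · have h1 : (fun y : G => tdiff I f (w * zeroSec I y)) =
        fun y => (mfderiv I 𝓘(ℝ, F) (fun x => f (x * y)) w.1 w.2 : F) := by
      funext y
      rw [mul_zeroSec]
      exact (DFunLike.congr_fun (mfderiv_comp (I' := I) w.1 (hf.mdifferentiable (by simp) _)
        (mdiff_right (I := I) y w.1)) w.2).symm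
    have h2 : leftDer I v.1 f = fun x => differential I (fun y => f (x * y)) 1 v.1 :=
      funext fun x => leftDer_eq_differential_mul _ hf x
    rw [h1, h2]
    exact mfderiv_mfderiv_comm (Φ := fun p : G × G => f (p.1 * p.2)) (hf.comp (contMDiff_mul I ∞))
      w.1 1 w.2 v.1
  · have h1 : (fun t : E => tdiff I f (w * fiberIncl I 1 t)) =
        fun t => differential I f w.1 w.2 + (differential I f w.1).comp (leftDeriv I w.1) t := by
      funext t
      rw [mul_fiberIncl]
      exact map_add (differential I f w.1) _ _
    have h2 : HasFDerivAt (fun t => differential I f w.1 w.2 +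
        (differential I f w.1).comp (leftDeriv I w.1) t)
        ((differential I f w.1).comp (leftDeriv I w.1)) 0 :=
      (ContinuousLinearMap.hasFDerivAt _).const_add _
    rw [h1]
    exact DFunLike.congr_fun h2.hasMFDerivAt.mfderiv v.2

/-- The Lie algebra of `TG` is the semidirect product of the Lie algebra of `G` with its adjoint
representation. The two components of the bracket are detected at the identity by its action on the
functions `f ∘ π` and `df` respectively. -/
theorem lieBr_tangent [I.Boundaryless] [FiniteDimensional ℝ E] [T2Space G] (v v' : E × E) :
    lieBr I.tangent (TangentBundle I G) v v' =
      (lieBr I G v.1 v'.1, lieBr I G v.1 v'.2 + lieBr I G v.2 v'.1) := by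
  have hv : ∀ (f : G → E) (a : E), tdiff I (leftDer I a f) (1 : TangentBundle I G) = 0 :=
    fun f a => map_zero (differential I (leftDer I a f) 1)
  refine Prod.ext ?_ ?_
  · refine eq_of_forall_differential_eq (I := I) (x := (1 : G)) fun f hf => ?_
    have h := leftDer_lieBr v v' (contMDiff_comp_proj hf) (1 : TangentBundle I G)
    rw [leftDer_comp_proj hf, leftDer_comp_proj hf, leftDer_comp_proj hf,
      leftDer_comp_proj (contMDiff_leftDer _ hf), leftDer_comp_proj (contMDiff_leftDer _ hf)] at h
    rw [← leftDer_one, ← leftDer_one, leftDer_lieBr _ _ hf]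
    exact h
  · refine eq_of_forall_differential_eq (I := I) (x := (1 : G)) fun f hf => ?_
    have h := leftDer_lieBr v v' (contMDiff_tdiff hf) (1 : TangentBundle I G)
    have hc := fun a : E => contMDiff_leftDer (I := I) a hf
    rw [leftDer_tdiff hf, leftDer_tdiff hf, leftDer_tdiff hf,
      leftDer_add_fun _ (contMDiff_tdiff (hc _)) (contMDiff_comp_proj (hc _)),
      leftDer_add_fun _ (contMDiff_tdiff (hc _)) (contMDiff_comp_proj (hc _)),
      leftDer_tdiff (hc _), leftDer_tdiff (hc _), leftDer_comp_proj (hc _),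
      leftDer_comp_proj (hc _)] at h
    simp only [Pi.add_apply, hv] at h
    dsimp only
    rw [map_add, ← leftDer_one, ← leftDer_one, ← leftDer_one, leftDer_lieBr _ _ hf,
      leftDer_lieBr _ _ hf]
    have h1 : (1 : TangentBundle I G).proj = 1 := rfl
    rw [h1] at h
    refine Eq.trans (?_ : _ = _) (h.trans ?_)
    · exact (zero_add _).symm
    · abel

end TangentBracket

/-! ### Lifts of left-invariant vector fields -/

section Lift

variable {E : Type*} [NormedAddCommGroup E] [NormedSpace ℝ E]
  {H : Type*} [TopologicalSpace H] {I : ModelWithCorners ℝ E H}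
  {G : Type*} [TopologicalSpace G] [ChartedSpace H G] [Group G] [LieGroup I ∞ G]

theorem mfderiv_mul_curve (x : G) {c : ℝ → G} (hc : c 0 = 1)
    (hd : MDifferentiableAt 𝓘(ℝ, ℝ) I c 0) :
    (mfderiv 𝓘(ℝ, ℝ) I (fun t => x * c t) 0 (1 : ℝ) : E) =
      leftDeriv I x (mfderiv 𝓘(ℝ, ℝ) I c 0 (1 : ℝ) : E) := by
  have h := DFunLike.congr_fun
    (mfderiv_comp (I' := I) (0 : ℝ) (mdiff_left (I := I) x (c 0)) hd) (1 : ℝ)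
  exact Eq.trans (b := (_ : E)) h (mfderiv_mul_left_of_eq I rfl hc _)

/-- The curve `t ↦ t b` in the fibre over the identity is differentiable with velocity `(0, b)`. -/
theorem mfderiv_fiberIncl_smul (b : E) :
    MDifferentiableAt 𝓘(ℝ, ℝ) I.tangent (fun t : ℝ => fiberIncl I (1 : G) (t • b)) 0 ∧
    (mfderiv 𝓘(ℝ, ℝ) I.tangent (fun t : ℝ => fiberIncl I (1 : G) (t • b)) 0 (1 : ℝ) : E × E) =
      (0, b) := by
  have h1 : HasFDerivAt (fun t : ℝ => t • b) ((1 : ℝ →L[ℝ] ℝ).smulRight b) 0 :=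
    ((1 : ℝ →L[ℝ] ℝ).smulRight b).hasFDerivAt
  have h2 : ∀ y : E, MDifferentiableAt 𝓘(ℝ, E) I.tangent (fiberIncl I (1 : G)) y :=
    fun y => (contMDiff_fiberIncl (1 : G)).mdifferentiable (by simp) y
  refine ⟨(h2 _).comp (0 : ℝ) h1.hasMFDerivAt.mdifferentiableAt, ?_⟩
  have h := DFunLike.congr_fun (mfderiv_comp (I' := 𝓘(ℝ, E)) (0 : ℝ) (h2 ((0 : ℝ) • b))
    h1.hasMFDerivAt.mdifferentiableAt) (1 : ℝ)
  rw [h1.hasMFDerivAt.mfderiv] at h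
  have h3 : ∀ y v : E, y = 0 → v = b →
      (mfderiv 𝓘(ℝ, E) I.tangent (fiberIncl I (1 : G)) y v : E × E) = (0, b) := by
    rintro _ _ rfl rfl
    exact mfderiv_fiberIncl _ _
  exact Eq.trans (b := (_ : E × E)) h (h3 _ _ (zero_smul ℝ b) (one_smul ℝ b))

/-- The vertical lift of a left-invariant vector field is left-invariant. -/
theorem verticalLift_mulInvariantVectorField (b : E) (w : TangentBundle I G) :
    (verticalLift (mulInvariantVectorField (b : GroupLieAlgebra I G)) w : E × E) =
      leftDeriv I.tangent w ((0 : E), b) := by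
  obtain ⟨h1, h2⟩ := mfderiv_fiberIncl_smul (I := I) (G := G) b
  have h3 := mfderiv_mul_curve w (c := fun t : ℝ => fiberIncl I (1 : G) (t • b))
    (tangentBundle_ext rfl (zero_smul ℝ b)) h1
  rw [h2] at h3
  refine Eq.trans ?_ h3
  have h4 : (fun t : ℝ => (⟨w.proj, HAdd.hAdd (α := E) (β := E) (γ := E) w.2
      (t • leftDeriv I w.proj b)⟩ : TangentBundle I G)) =
      fun t : ℝ => w * fiberIncl I (1 : G) (t • b) := by
    funext t
    rw [mul_fiberIncl, map_smul]
  exact congrArg (fun f : ℝ → TangentBundle I G =>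
    (mfderiv 𝓘(ℝ, ℝ) I.tangent f 0 (1 : ℝ) : E × E)) h4

/-- Left translates of integral curves of a left-invariant vector field are integral curves. -/
theorem hasMFDerivAt_mul_integralCurve {a : E} {γ : ℝ → G} {t : ℝ}
    (h : HasMFDerivAt 𝓘(ℝ, ℝ) I γ t ((1 : ℝ →L[ℝ] ℝ).smulRight
      (mulInvariantVectorField (a : GroupLieAlgebra I G) (γ t)))) (y : G) :
    HasMFDerivAt 𝓘(ℝ, ℝ) I (fun s => y * γ s) t ((1 : ℝ →L[ℝ] ℝ).smulRight
      (mulInvariantVectorField (a : GroupLieAlgebra I G) (y * γ t))) := by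
  have h1 := (mdiff_left (I := I) y (γ t)).hasMFDerivAt.comp t h
  have h2 : (mfderiv I I (fun z : G => y * z) (γ t) (leftDeriv I (γ t) a) : E) =
      leftDeriv I (y * γ t) a :=
    (mfderiv_mul_left_of_eq I rfl (mul_one _).symm _).trans (mfderiv_mul_left_comp I y (γ t) 1 a)
  refine h1.congr_mfderiv (ContinuousLinearMap.ext fun (s : ℝ) => ?_)
  refine Eq.trans (b := (_ : E)) (map_smul (mfderiv I I (fun z : G => y * z) (γ t)) s
    (leftDeriv I (γ t) a)) ?_
  exact congrArg (fun v : E => s • v) h2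

/-- The local flow of a left-invariant vector field is given by right translations by the points
of its integral curve `γ` through the identity. -/
theorem isLocalFlow_mul {a : E} {γ : ℝ → G} (h0 : γ 0 = 1)
    (hγ : IsMIntegralCurveAt γ (mulInvariantVectorField (I := I) (a : GroupLieAlgebra I G)) 0)
    (x : G) :
    IsLocalFlow (mulInvariantVectorField (I := I) (a : GroupLieAlgebra I G))
      (fun t y => y * γ t) x := by
  refine ⟨Eventually.of_forall fun y => by simp [h0], ?_⟩
  have h : ∀ᶠ p : ℝ × G in 𝓝 ((0 : ℝ), x), HasMFDerivAt 𝓘(ℝ, ℝ) I γ p.1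
      ((1 : ℝ →L[ℝ] ℝ).smulRight (mulInvariantVectorField (a : GroupLieAlgebra I G) (γ p.1))) :=
    (continuous_fst (X := ℝ) (Y := G)).continuousAt (x := ((0 : ℝ), x)) |>.eventually hγ
  filter_upwards [h] with p hp
  exact hasMFDerivAt_mul_integralCurve hp p.2

variable [I.Boundaryless] [T2Space G]

omit [I.Boundaryless] in
/-- Every local flow of a left-invariant vector field consists of right translations, by uniqueness
of integral curves on a time interval that is common to all points near `x`. -/
theorem IsLocalFlow.eventually_eq_mul [BoundarylessManifold I G] [CompleteSpace E] {a : E}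
    {γ : ℝ → G} (h0 : γ 0 = 1)
    (hγ : IsMIntegralCurveAt γ (mulInvariantVectorField (I := I) (a : GroupLieAlgebra I G)) 0)
    {φ : ℝ → G → G} {x : G}
    (hφ : IsLocalFlow (mulInvariantVectorField (I := I) (a : GroupLieAlgebra I G)) φ x) :
    ∀ᶠ t in 𝓝 (0 : ℝ), ∀ᶠ y in 𝓝 x, φ t y = y * γ t := by
  have h1 : ∀ᶠ p : ℝ × G in 𝓝 (0 : ℝ) ×ˢ 𝓝 x, HasMFDerivAt 𝓘(ℝ, ℝ) I (fun t => φ t p.2) p.1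
      ((1 : ℝ →L[ℝ] ℝ).smulRight
        (mulInvariantVectorField (a : GroupLieAlgebra I G) (φ p.1 p.2))) := by
    rw [← nhds_prod_eq]
    exact hφ.2
  obtain ⟨P, hP, Q, hQ, h2⟩ := eventually_prod_iff.1 h1
  obtain ⟨ε, hε, hball⟩ := Metric.eventually_nhds_iff.1 (hP.and hγ)
  have hIoo : ∀ t ∈ Set.Ioo (-ε) ε, dist t 0 < ε := fun t ht => by
    rw [Real.dist_0_eq_abs]
    exact abs_lt.2 ht
  have key : ∀ y, Q y → φ 0 y = y → Set.EqOn (fun t => φ t y) (fun t => y * γ t)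
      (Set.Ioo (-ε) ε) := fun y hy hy0 =>
    isMIntegralCurveOn_Ioo_eqOn_of_contMDiff_boundaryless (I := I) (t₀ := 0)
      (v := mulInvariantVectorField (I := I) (a : GroupLieAlgebra I G)) ⟨by linarith, hε⟩
      ((contMDiff_leftInvariant a).of_le (by norm_cast))
      (fun t ht => (h2 (hball (hIoo t ht)).1 hy).hasMFDerivWithinAt)
      (fun t ht => (hasMFDerivAt_mul_integralCurve (hball (hIoo t ht)).2 y).hasMFDerivWithinAt)
      (by simp [hy0, h0])
  filter_upwards [Ioo_mem_nhds (neg_lt_zero.2 hε) hε] with t ht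
  filter_upwards [hQ, hφ.1] with y hy hy0
  exact key y hy hy0 ht

/-- The complete lift of a left-invariant vector field is left-invariant. -/
theorem completeLift_mulInvariantVectorField [CompleteSpace E] (a : E) (w : TangentBundle I G) :
    (completeLift (mulInvariantVectorField (a : GroupLieAlgebra I G)) w : E × E) =
      leftDeriv I.tangent w (a, (0 : E)) := by
  have : IsManifold I 1 G := inferInstance
  obtain ⟨γ, h0, hγ⟩ := exists_isMIntegralCurveAt_of_contMDiffAt_boundaryless (I := I) (0 : ℝ)
    (((contMDiff_leftInvariant (I := I) (G := G) a).of_le (n := ∞) (m := 1) (by norm_cast)) 1)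
  have hex : ∃ φ : ℝ → G → G,
      IsLocalFlow (mulInvariantVectorField (I := I) (a : GroupLieAlgebra I G)) φ w.proj :=
    ⟨_, isLocalFlow_mul h0 hγ w.proj⟩
  refine Eq.trans (b := (_ : E × E)) (dif_pos hex) ?_
  have h1 : (fun t : ℝ => tangentMap I I (hex.choose t) w) =ᶠ[𝓝 0]
      fun t => w * zeroSec I (γ t) := by
    filter_upwards [IsLocalFlow.eventually_eq_mul h0 hγ hex.choose_spec] with t ht
    rw [mul_zeroSec]
    have e : hex.choose t =ᶠ[𝓝 w.proj] fun y => y * γ t := ht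
    exact tangentBundle_ext e.eq_of_nhds
      (congrArg (fun A : E →L[ℝ] E => A w.2) (Filter.EventuallyEq.mfderiv_eq (I := I) (I' := I) e))
  have hd : MDifferentiableAt 𝓘(ℝ, ℝ) I γ 0 := hγ.hasMFDerivAt.mdifferentiableAt
  have hz : MDifferentiableAt I I.tangent (zeroSec I) (γ 0) :=
    contMDiff_zeroSec.mdifferentiable (by simp) _
  have h2 := mfderiv_mul_curve w (c := fun t => zeroSec I (γ t))
    (tangentBundle_ext h0 rfl) (hz.comp 0 hd)
  have h3 : (mfderiv 𝓘(ℝ, ℝ) I.tangent (fun t => zeroSec I (γ t)) 0 (1 : ℝ) : E × E) = (a, 0) := by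
    have h4 := DFunLike.congr_fun (mfderiv_comp (I' := I) (0 : ℝ) hz hd) (1 : ℝ)
    refine Eq.trans (b := (_ : E × E)) h4 ((mfderiv_zeroSec (I := I) (γ 0) _).trans ?_)
    have h5 : (mfderiv 𝓘(ℝ, ℝ) I γ 0 (1 : ℝ) : E) = (1 : ℝ) • leftDeriv I (γ 0) a :=
      DFunLike.congr_fun hγ.hasMFDerivAt.mfderiv (1 : ℝ)
    refine congrArg (fun v : E => (v, (0 : E))) (h5.trans ?_)
    rw [one_smul, h0, leftDeriv_one]
  rw [h3] at h2
  exact Eq.trans (b := (_ : E × E)) (DFunLike.congr_fun h1.mfderiv_eq (1 : ℝ)) h2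

theorem isLiftedMetric_tangentMetric [FiniteDimensional ℝ E]
    (g : ContMDiffRiemannianMetric I ∞ E (TangentSpace I : G → Type _)) (hg : IsLeftInvariant g) :
    IsLiftedMetric g (tangentMetric g) := by
  have hs : ∀ (w : TangentBundle I G) (u v : E × E),
      leftForm (I := I.tangent) (tangentForm g) w (leftDeriv I.tangent w u)
        (leftDeriv I.tangent w v) = g.inner 1 u.1 v.1 + g.inner 1 u.2 v.2 :=
    fun w u v => leftForm_leftDeriv (tangentForm g) w u v
  have hz : ∀ u : E, g.inner 1 (0 : E) u = 0 := fun u =>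
    DFunLike.congr_fun (map_zero (g.inner 1)) u
  have hz' : ∀ u : E, g.inner 1 u (0 : E) = 0 := fun u => map_zero (g.inner 1 u)
  have : CompleteSpace E := FiniteDimensional.complete ℝ E
  refine ⟨isLeftInvariant_leftInvariantMetric _ _ _, fun x y w => ?_, fun x y w => ?_,
    fun x y w => ?_⟩
  · refine (congrArg₂ (fun u v : E × E => leftForm (I := I.tangent) (tangentForm g) w u v)
      (completeLift_mulInvariantVectorField (E := E) x w)
      (completeLift_mulInvariantVectorField (E := E) y w)).trans ((hs w _ _).trans ?_)
    refine Eq.trans ?_ (hg.inner_leftDeriv w.proj x y).symm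
    exact (congrArg (HAdd.hAdd _) (hz 0)).trans (add_zero _)
  · refine (congrArg₂ (fun u v : E × E => leftForm (I := I.tangent) (tangentForm g) w u v)
      (verticalLift_mulInvariantVectorField (E := E) x w)
      (verticalLift_mulInvariantVectorField (E := E) y w)).trans ((hs w _ _).trans ?_)
    refine Eq.trans ?_ (hg.inner_leftDeriv w.proj x y).symm
    exact (congrArg (fun t : ℝ => t + _) (hz 0)).trans (zero_add _)
  · refine (congrArg₂ (fun u v : E × E => leftForm (I := I.tangent) (tangentForm g) w u v)
      (completeLift_mulInvariantVectorField (E := E) x w)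
      (verticalLift_mulInvariantVectorField (E := E) y w)).trans ((hs w _ _).trans ?_)
    exact (congrArg₂ HAdd.hAdd (hz' x) (hz y)).trans (add_zero _)

end Lift

/-! ### Special Lie algebras -/

section SpecialBracket

variable {V : Type*} [AddCommGroup V] [Module ℝ V] [FiniteDimensional ℝ V]

/-- An endomorphism `f` with `f x = 0` and `f y ∈ span {x, y}` for all `y` acts on `V / span {x}` by
a scalar, which is read off from the trace of `f`. -/
theorem exists_trace_eq_and_eq_smul_add {x : V} (hx : x ≠ 0) {f : V →ₗ[ℝ] V} (hfx : f x = 0)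
    (hf : ∀ y, ∃ a b : ℝ, f y = a • x + b • y) :
    ∃ c : ℝ, LinearMap.trace ℝ V f = c * (Module.finrank ℝ V - 1) ∧
      ∀ y, ∃ m : ℝ, f y = c • y + m • x := by
  let S : Submodule ℝ V := Submodule.span ℝ {x}
  have hS : S ≤ S.comap f := by
    rw [Submodule.span_singleton_le_iff_mem, Submodule.mem_comap, hfx]
    exact S.zero_mem
  obtain ⟨c, hc⟩ : ∃ c : ℝ, S.mapQ S f hS = c • 1 := by
    refine LinearMap.exists_eq_smul_id_of_forall_notLinearIndependent fun v => ?_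
    obtain ⟨y, rfl⟩ := S.mkQ_surjective v
    obtain ⟨a, b, hab⟩ := hf y
    have h0 : S.mkQ x = 0 :=
      (Submodule.Quotient.mk_eq_zero S).2 (Submodule.mem_span_singleton_self x)
    have h1 : S.mapQ S f hS (S.mkQ y) = b • S.mkQ y := by
      rw [Submodule.mkQ_apply, Submodule.mapQ_apply, ← Submodule.mkQ_apply, hab, map_add, map_smul,
        map_smul, h0, smul_zero, zero_add, Submodule.mkQ_apply]
    rw [h1, LinearIndependent.pair_iff]
    intro h
    simpa using (h (-b) 1 (by simp)).2
  have hm : ∀ y, ∃ m : ℝ, f y = c • y + m • x := fun y => by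
    have h1 : f y - c • y ∈ S := by
      rw [← Submodule.Quotient.mk_eq_zero, Submodule.Quotient.mk_sub, sub_eq_zero]
      exact DFunLike.congr_fun hc (S.mkQ y)
    obtain ⟨m, hm⟩ := Submodule.mem_span_singleton.1 h1
    exact ⟨m, by rw [hm]; abel⟩
  obtain ⟨φ, hφ⟩ : ∃ φ : Module.Dual ℝ V, φ x = 1 := by
    obtain ⟨φ, hφ⟩ : ∃ φ : Module.Dual ℝ V, φ x ≠ 0 := by
      by_contra! h
      exact hx ((Module.forall_dual_apply_eq_zero_iff ℝ x).1 h)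
    exact ⟨(φ x)⁻¹ • φ, by simp [hφ]⟩
  have hdec : f = c • LinearMap.id + (φ ∘ₗ (f - c • LinearMap.id)).smulRight x := by
    ext y
    obtain ⟨m, hm⟩ := hm y
    simp [hm, hφ]
  refine ⟨c, ?_, hm⟩
  rw [hdec, map_add, map_smul, LinearMap.trace_smulRight, LinearMap.trace_id]
  simp [hfx, hφ]
  ring

/-- The scalar by which `ad x` acts on `V / span {x}` is linear in `x`, being a multiple of the
trace of `ad x`. -/
theorem exists_dual_of_bracket_mem_span {br : V →ₗ[ℝ] V →ₗ[ℝ] V} (halt : ∀ x, br x x = 0)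
    (hspan : ∀ x y, ∃ a b : ℝ, br x y = a • x + b • y) (hne : ∃ x y, br x y ≠ 0) :
    ∃ l : Module.Dual ℝ V, ∀ x y, br x y = l x • y - l y • x := by
  have hanti : ∀ x y, br x y + br y x = 0 := fun x y => by
    have h := halt (x + y)
    simp only [map_add, LinearMap.add_apply, halt, zero_add, add_zero] at h
    rwa [add_comm]
  have hn : (Module.finrank ℝ V - 1 : ℝ) ≠ 0 := by
    obtain ⟨x, y, hxy⟩ := hne
    have hi : LinearIndependent ℝ ![x, y] := by
      rw [LinearIndependent.pair_iff']
      · rintro a rfl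
        exact hxy (by rw [map_smul, halt, smul_zero])
      · rintro rfl
        exact hxy (by simp)
    have h2 := hi.fintype_card_le_finrank
    rw [Fintype.card_fin] at h2
    have h3 : (2 : ℝ) ≤ Module.finrank ℝ V := by exact_mod_cast h2
    linarith
  let l : Module.Dual ℝ V := (Module.finrank ℝ V - 1 : ℝ)⁻¹ • LinearMap.trace ℝ V ∘ₗ br
  have hl : ∀ x, x ≠ 0 → ∀ y, ∃ m : ℝ, br x y = l x • y + m • x := fun x hx y => by
    obtain ⟨c, hc, h⟩ := exists_trace_eq_and_eq_smul_add hx (halt x) (hspan x)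
    have hlx : l x = c := by
      simp only [l, LinearMap.smul_apply, LinearMap.comp_apply, hc, smul_eq_mul]
      field_simp
    rw [hlx]
    exact h y
  refine ⟨l, fun x y => ?_⟩
  by_cases hx : x = 0
  · subst hx
    simp
  by_cases hxy : ∃ a : ℝ, a • x = y
  · obtain ⟨a, rfl⟩ := hxy
    simp [halt, smul_smul, mul_comm]
  have hi : LinearIndependent ℝ ![x, y] :=
    (LinearIndependent.pair_iff' hx).2 fun a ha => hxy ⟨a, ha⟩
  have hy : y ≠ 0 := fun hy => hxy ⟨0, by rw [hy, zero_smul]⟩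
  obtain ⟨m, hm⟩ := hl x hx y
  obtain ⟨m', hm'⟩ := hl y hy x
  have h := hanti x y
  rw [hm, hm'] at h
  have h2 := (LinearIndependent.pair_iff.1 hi (m + l y) (l x + m') (by rw [← h]; module)).1
  rw [hm, show m = -l y by linarith]
  module

end SpecialBracket

section SpecialAlgebra

variable {E : Type*} [NormedAddCommGroup E] [NormedSpace ℝ E]
  {H : Type*} [TopologicalSpace H] {I : ModelWithCorners ℝ E H}
  {G : Type*} [TopologicalSpace G] [ChartedSpace H G] [Group G] [LieGroup I ∞ G]
  [FiniteDimensional ℝ E]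

/-- The bracket of a special Lie algebra with an inner product `B` is
`[x, y] = B(ξ, x) y - B(ξ, y) x` for a vector `ξ ≠ 0`. The vector `e` shows that the dimension is at
least two. -/
theorem IsSpecial.exists_lieBr_eq (hG : IsSpecial I G) {B : E →L[ℝ] E →L[ℝ] ℝ}
    (hpos : ∀ v, v ≠ 0 → 0 < B v v) :
    ∃ ξ e : E, ξ ≠ 0 ∧ e ≠ 0 ∧ B ξ e = 0 ∧
      ∀ x y, lieBr I G x y = B ξ x • y - B ξ y • x := by
  have : LieGroup I (minSmoothness ℝ 3) G := by
    rw [minSmoothness_of_isRCLikeNormedField]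
    exact LieGroup.of_le (n := ∞) (by norm_cast)
  have : CompleteSpace E := FiniteDimensional.complete ℝ E
  obtain ⟨⟨(x₀ : E), (y₀ : E), h₀⟩, hspan⟩ := hG
  let br : E →ₗ[ℝ] E →ₗ[ℝ] E := LinearMap.mk₂ ℝ (lieBr I G)
    (fun a b c => add_lie (L := GroupLieAlgebra I G) (M := GroupLieAlgebra I G) a b c)
    (fun t a b => smul_lie (L := GroupLieAlgebra I G) (M := GroupLieAlgebra I G) t a b)
    (fun a b c => lie_add (L := GroupLieAlgebra I G) (M := GroupLieAlgebra I G) a b c)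
    (fun t a b => lie_smul (L := GroupLieAlgebra I G) (M := GroupLieAlgebra I G) t a b)
  obtain ⟨l, hl⟩ := exists_dual_of_bracket_mem_span (br := br)
    (fun x => lie_self (L := GroupLieAlgebra I G) x) (fun x y => hspan x y) ⟨x₀, y₀, h₀⟩
  let B' : E →ₗ[ℝ] Module.Dual ℝ E := ContinuousLinearMap.coeLM ℝ ∘ₗ B.toLinearMap
  have hinj : Function.Injective B' := by
    rw [injective_iff_map_eq_zero]
    intro v hv
    by_contra h
    exact (hpos v h).ne' (DFunLike.congr_fun hv v)
  obtain ⟨ξ, hξ⟩ := (LinearMap.injective_iff_surjective_of_finrank_eq_finrank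
    (Subspace.dual_finrank_eq (K := ℝ) (V := E)).symm).1 hinj l
  have hl' : ∀ x, l x = B ξ x := fun x => (DFunLike.congr_fun hξ x).symm
  have hbr : ∀ x y, lieBr I G x y = B ξ x • y - B ξ y • x := fun x y => by
    rw [← hl', ← hl']
    exact hl x y
  refine ⟨ξ, lieBr I G x₀ y₀, ?_, h₀, ?_, hbr⟩
  · rintro rfl
    have h := hbr x₀ y₀
    rw [map_zero, zero_apply, zero_apply, zero_smul, zero_smul, sub_zero] at h
    exact h₀ h
  · rw [hbr, map_sub, map_smul, map_smul, smul_eq_mul, smul_eq_mul]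
    ring

end SpecialAlgebra

section Product

variable {E : Type*} [NormedAddCommGroup E] [NormedSpace ℝ E] [FiniteDimensional ℝ E]

/-- The Levi-Civita product `Γ_x y = B(x, y) ξ - B(ξ, y) x` of the bracket
`[x, y] = B(ξ, x) y - B(ξ, y) x`. -/
def specialProduct (B : E →L[ℝ] E →L[ℝ] ℝ) (ξ : E) : E →L[ℝ] E →L[ℝ] E :=
  (LinearMap.mk₂ ℝ (fun x y => B x y • ξ - B ξ y • x)
    (fun a b c => by simp only [map_add, add_apply]; module)
    (fun t a b => by simp only [map_smul, smul_apply, smul_eq_mul]; module)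
    (fun a b c => by simp only [map_add]; module)
    (fun t a b => by simp only [map_smul, smul_eq_mul]; module)).toContinuousBilinearMap

theorem specialProduct_apply (B : E →L[ℝ] E →L[ℝ] ℝ) (ξ x y : E) :
    specialProduct B ξ x y = B x y • ξ - B ξ y • x := rfl

/-- The product `specialProduct` has constant curvature `-B(ξ, ξ)`. -/
theorem algCurvature_specialProduct {B : E →L[ℝ] E →L[ℝ] ℝ} (hsymm : ∀ u v, B u v = B v u)
    (ξ a b : E) : B (algCurvature (specialProduct B ξ) a b b) a =
      -B ξ ξ * (B a a * B b b - B a b ^ 2) := by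
  simp only [algCurvature, specialProduct_apply, map_sub, map_smul, sub_apply, smul_apply,
    smul_eq_mul, hsymm b a, hsymm a ξ, hsymm b ξ]
  ring

/-- The Levi-Civita product of the semidirect product of the Lie algebra with bracket
`[x, y] = B(ξ, x) y - B(ξ, y) x` and its adjoint representation, for the inner product `B ⊕ B`. -/
def specialTangentProduct (B : E →L[ℝ] E →L[ℝ] ℝ) (ξ : E) :
    E × E →L[ℝ] E × E →L[ℝ] E × E :=
  (LinearMap.mk₂ ℝ (fun u v =>
    ((B u.1 v.1 + B u.2 v.2) • ξ - B ξ v.1 • u.1 - (2⁻¹ * B ξ u.2) • v.2 - (2⁻¹ * B ξ v.2) • u.2,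
      (2⁻¹ * (B u.1 v.2 + B v.1 u.2)) • ξ - (2⁻¹ * B ξ v.2) • u.1 + (2⁻¹ * B ξ u.2) • v.1 -
        B ξ v.1 • u.2))
    (fun a b c => by
      simp only [Prod.fst_add, Prod.snd_add, map_add, add_apply, Prod.mk_add_mk]
      congr 1 <;> module)
    (fun t a b => by
      simp only [Prod.smul_fst, Prod.smul_snd, map_smul, smul_apply, smul_eq_mul, Prod.smul_mk]
      congr 1 <;> module)
    (fun a b c => by
      simp only [Prod.fst_add, Prod.snd_add, map_add, add_apply, Prod.mk_add_mk]
      congr 1 <;> module)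
    (fun t a b => by
      simp only [Prod.smul_fst, Prod.smul_snd, map_smul, smul_apply, smul_eq_mul, Prod.smul_mk]
      congr 1 <;> module)).toContinuousBilinearMap

theorem specialTangentProduct_apply (B : E →L[ℝ] E →L[ℝ] ℝ) (ξ : E) (u v : E × E) :
    specialTangentProduct B ξ u v =
    ((B u.1 v.1 + B u.2 v.2) • ξ - B ξ v.1 • u.1 - (2⁻¹ * B ξ u.2) • v.2 - (2⁻¹ * B ξ v.2) • u.2,
      (2⁻¹ * (B u.1 v.2 + B v.1 u.2)) • ξ - (2⁻¹ * B ξ v.2) • u.1 + (2⁻¹ * B ξ u.2) • v.1 -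
        B ξ v.1 • u.2) := rfl

omit [FiniteDimensional ℝ E] in
/-- Strict Cauchy–Schwarz inequality for a positive definite bilinear form. -/
theorem gram_pos {B : E →L[ℝ] E →L[ℝ] ℝ} (hsymm : ∀ u v, B u v = B v u)
    (hpos : ∀ v, v ≠ 0 → 0 < B v v) {u v : E} (h : LinearIndependent ℝ ![u, v]) :
    0 < B u u * B v v - B u v ^ 2 := by
  have hu : u ≠ 0 := h.ne_zero 0
  have h1 : B u u • v - B u v • u ≠ 0 := fun h0 =>
    (hpos u hu).ne' (LinearIndependent.pair_iff.1 h (-B u v) (B u u) (by rw [← h0]; module)).2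
  have h2 := hpos _ h1
  have h3 : B (B u u • v - B u v • u) (B u u • v - B u v • u) =
      B u u * (B u u * B v v - B u v ^ 2) := by
    simp only [map_sub, map_smul, sub_apply, smul_apply, smul_eq_mul, hsymm v u]
    ring
  rw [h3] at h2
  exact pos_of_mul_pos_right h2 (hpos u hu).le

theorem specialProduct_sub (B : E →L[ℝ] E →L[ℝ] ℝ) (hsymm : ∀ u v, B u v = B v u) (ξ x y : E) :
    specialProduct B ξ x y - specialProduct B ξ y x = B ξ x • y - B ξ y • x := by
  rw [specialProduct_apply, specialProduct_apply, hsymm y x]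
  module

theorem specialProduct_skew (B : E →L[ℝ] E →L[ℝ] ℝ) (hsymm : ∀ u v, B u v = B v u) (ξ a b c : E) :
    B (specialProduct B ξ a b) c + B b (specialProduct B ξ a c) = 0 := by
  simp only [specialProduct_apply, map_sub, map_smul, sub_apply, smul_apply, smul_eq_mul,
    hsymm b ξ, hsymm b a]
  ring

theorem specialTangentProduct_sub (B : E →L[ℝ] E →L[ℝ] ℝ) (hsymm : ∀ u v, B u v = B v u) (ξ : E)
    (u v : E × E) :
    specialTangentProduct B ξ u v - specialTangentProduct B ξ v u =
      (B ξ u.1 • v.1 - B ξ v.1 • u.1,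
        (B ξ u.1 • v.2 - B ξ v.2 • u.1) + (B ξ u.2 • v.1 - B ξ v.1 • u.2)) := by
  rw [specialTangentProduct_apply, specialTangentProduct_apply, hsymm v.1 u.1, hsymm v.2 u.2,
    Prod.mk_sub_mk]
  congr 1 <;> module

theorem specialTangentProduct_skew (B : E →L[ℝ] E →L[ℝ] ℝ) (hsymm : ∀ u v, B u v = B v u) (ξ : E)
    {T : E × E →L[ℝ] E × E →L[ℝ] ℝ} (hT : ∀ u v, T u v = B u.1 v.1 + B u.2 v.2) (u v w : E × E) :
    T (specialTangentProduct B ξ u v) w + T v (specialTangentProduct B ξ u w) = 0 := by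
  simp only [hT, specialTangentProduct_apply, map_sub, map_add, map_smul, sub_apply, add_apply,
    smul_apply, smul_eq_mul, hsymm _ ξ, hsymm v.1 u.1, hsymm v.1 u.2, hsymm v.2 u.1,
    hsymm v.2 u.2, hsymm v.1 w.2, hsymm v.2 w.1, hsymm w.1 u.2]
  ring

/-- For `e ≠ 0` the plane of the vertical vectors `(0, ξ)`, `(0, e)` has positive curvature. -/
theorem algCurvature_vertical {B : E →L[ℝ] E →L[ℝ] ℝ} (hsymm : ∀ u v, B u v = B v u) {ξ e : E}
    (he : B ξ e = 0) {T : E × E →L[ℝ] E × E →L[ℝ] ℝ}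
    (hT : ∀ u v, T u v = B u.1 v.1 + B u.2 v.2) :
    T (algCurvature (specialTangentProduct B ξ) (0, ξ) (0, e) (0, e)) (0, ξ) =
      B ξ ξ ^ 2 * B e e / 4 := by
  simp only [hT, algCurvature, specialTangentProduct_apply, map_sub, map_add, map_smul, map_zero,
    sub_apply, add_apply, smul_apply, zero_apply, smul_eq_mul, hsymm e ξ, he]
  ring

/-- For `e ≠ 0` the plane of the horizontal vectors `(ξ, 0)`, `(e, 0)` has negative curvature. -/
theorem algCurvature_horizontal {B : E →L[ℝ] E →L[ℝ] ℝ} (hsymm : ∀ u v, B u v = B v u) {ξ e : E}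
    (he : B ξ e = 0) {T : E × E →L[ℝ] E × E →L[ℝ] ℝ}
    (hT : ∀ u v, T u v = B u.1 v.1 + B u.2 v.2) :
    T (algCurvature (specialTangentProduct B ξ) (ξ, 0) (e, 0) (e, 0)) (ξ, 0) =
      -(B ξ ξ ^ 2 * B e e) := by
  simp only [hT, algCurvature, specialTangentProduct_apply, map_sub, map_add, map_smul, map_zero,
    sub_apply, add_apply, smul_apply, zero_apply, smul_eq_mul, hsymm e ξ, he]
  ring

/-- The plane of `(ξ, 0)`, `(0, ξ)` is flat. -/
theorem algCurvature_mixed {B : E →L[ℝ] E →L[ℝ] ℝ} {ξ : E}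
    {T : E × E →L[ℝ] E × E →L[ℝ] ℝ} (hT : ∀ u v, T u v = B u.1 v.1 + B u.2 v.2) :
    T (algCurvature (specialTangentProduct B ξ) (ξ, 0) (0, ξ) (0, ξ)) (ξ, 0) = 0 := by
  simp only [hT, algCurvature, specialTangentProduct_apply, map_sub, map_add, map_smul, map_zero,
    sub_apply, add_apply, smul_apply, zero_apply, smul_eq_mul]
  ring

end Product

/-! ### Sectional curvatures of a special Lie group and of its tangent group -/

section SpecialGroup

variable {E : Type*} [NormedAddCommGroup E] [NormedSpace ℝ E] [FiniteDimensional ℝ E]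
  {H : Type*} [TopologicalSpace H] {I : ModelWithCorners ℝ E H}
  {G : Type*} [TopologicalSpace G] [ChartedSpace H G] [Group G] [LieGroup I ∞ G]

omit [FiniteDimensional ℝ E] in
theorem linearIndependent_leftDeriv (x : G) (a b : E) :
    LinearIndependent ℝ (M := E) ![leftDeriv I x a, leftDeriv I x b] ↔
      LinearIndependent ℝ ![a, b] := by
  have hinj : Function.Injective (leftDeriv I x) :=
    Function.LeftInverse.injective (leftTrivialization_leftDeriv x)
  rw [LinearIndependent.pair_iff, LinearIndependent.pair_iff]
  refine forall₂_congr fun s t => imp_congr_left ?_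
  rw [← map_smul, ← map_smul, ← map_add, map_eq_zero_iff _ hinj]

variable {g : ContMDiffRiemannianMetric I ∞ E (TangentSpace I : G → Type _)}
  {B : E →L[ℝ] E →L[ℝ] ℝ} {ξ : E}

theorem sectionalCurvature_eq_neg (hg : IsLeftInvariant g) (hgB : ∀ a b : E, g.inner 1 a b = B a b)
    (hbr : ∀ x y, lieBr I G x y = B ξ x • y - B ξ y • x) (x : G) {u v : E}
    (huv : LinearIndependent ℝ ![u, v]) : sectionalCurvature g x u v = -B ξ ξ := by
  have hsymm : ∀ u v, B u v = B v u := fun u v =>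
    (hgB u v).symm.trans ((g.symm 1 u v).trans (hgB v u))
  have hpos : ∀ v, v ≠ 0 → 0 < B v v := fun v hv => (g.pos 1 v hv).trans_eq (hgB v v)
  obtain ⟨a, rfl⟩ : ∃ a, leftDeriv I x a = u := ⟨_, leftDeriv_leftTrivialization x u⟩
  obtain ⟨b, rfl⟩ : ∃ b, leftDeriv I x b = v := ⟨_, leftDeriv_leftTrivialization x v⟩
  have h := gram_pos hsymm hpos ((linearIndependent_leftDeriv x a b).1 huv)
  rw [sectionalCurvature_leftDeriv hg hgB (Γ := specialProduct B ξ)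
    (fun a b => (specialProduct_sub B hsymm ξ a b).trans (hbr a b).symm)
    (specialProduct_skew B hsymm ξ), algCurvature_specialProduct hsymm]
  exact mul_div_cancel_right₀ _ h.ne'

/-- The sectional curvature of `g̃` in terms of the product `specialTangentProduct` on the Lie
algebra `T_e G × T_e G` of `TG`. -/
theorem tangentMetric_sectionalCurvature [I.Boundaryless] [T2Space G]
    (hgB : ∀ a b : E, g.inner 1 a b = B a b)
    (hbr : ∀ x y, lieBr I G x y = B ξ x • y - B ξ y • x) (w : TangentBundle I G) (u v : E × E) :
    sectionalCurvature (tangentMetric g) w (leftDeriv I.tangent w u) (leftDeriv I.tangent w v) =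
      tangentForm g (algCurvature (specialTangentProduct B ξ) u v v) u /
        (tangentForm g u u * tangentForm g v v - tangentForm g u v ^ 2) := by
  have hsymm : ∀ u v, B u v = B v u := fun u v =>
    (hgB u v).symm.trans ((g.symm 1 u v).trans (hgB v u))
  have hT : ∀ u v, tangentForm g u v = B u.1 v.1 + B u.2 v.2 := fun u v =>
    congrArg₂ (· + ·) (hgB u.1 v.1) (hgB u.2 v.2)
  refine sectionalCurvature_leftDeriv (isLeftInvariant_leftInvariantMetric _ _ _) (fun a b => ?_)
    (fun a b => ?_) (specialTangentProduct_skew B hsymm ξ hT) w u v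
  · exact congrArg₂ (fun a b : E × E => tangentForm g a b) (leftTrivialization_one a)
      (leftTrivialization_one b)
  · rw [specialTangentProduct_sub B hsymm, lieBr_tangent, hbr, hbr, hbr]

end SpecialGroup

end TangentLie

end

open TangentLie
theorem mainTheorem2 {E : Type*} [NormedAddCommGroup E] [NormedSpace ℝ E] [FiniteDimensional ℝ E]
    {G : Type*} [TopologicalSpace G] [T2Space G] [ChartedSpace E G] [Group G]
    [LieGroup 𝓘(ℝ, E) ∞ G] (hG : IsSpecial 𝓘(ℝ, E) G)
    (g : ContMDiffRiemannianMetric 𝓘(ℝ, E) ∞ E (TangentSpace 𝓘(ℝ, E) : G → Type _))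
    (hg : IsLeftInvariant g) :
    IsLiftedMetric g (tangentMetric g) ∧
    (∃ c : ℝ, 0 < c ∧ ∀ (x : G) (u v : TangentSpace 𝓘(ℝ, E) x),
      LinearIndependent ℝ ![u, v] → sectionalCurvature g x u v = -c) ∧
    ∀ w : TangentBundle 𝓘(ℝ, E) G,
      (∃ u v : TangentSpace 𝓘(ℝ, E).tangent w, LinearIndependent ℝ ![u, v] ∧
        0 < sectionalCurvature (tangentMetric g) w u v) ∧
      (∃ u v : TangentSpace 𝓘(ℝ, E).tangent w, LinearIndependent ℝ ![u, v] ∧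
        sectionalCurvature (tangentMetric g) w u v < 0) ∧
      (∃ u v : TangentSpace 𝓘(ℝ, E).tangent w, LinearIndependent ℝ ![u, v] ∧
        sectionalCurvature (tangentMetric g) w u v = 0) := by
  obtain ⟨B, hgB⟩ : ∃ B : E →L[ℝ] E →L[ℝ] ℝ, ∀ a b : E, g.inner 1 a b = B a b :=
    ⟨g.inner 1, fun _ _ => rfl⟩
  have hsymm : ∀ u v, B u v = B v u := fun u v =>
    (hgB u v).symm.trans ((g.symm 1 u v).trans (hgB v u))
  have hpos : ∀ v, v ≠ 0 → 0 < B v v := fun v hv => (g.pos 1 v hv).trans_eq (hgB v v)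
  obtain ⟨ξ, e, hξ, he, hξe, hbr⟩ := hG.exists_lieBr_eq hpos
  refine ⟨isLiftedMetric_tangentMetric g hg, ⟨B ξ ξ, hpos ξ hξ, fun x u v huv =>
    sectionalCurvature_eq_neg hg hgB hbr x huv⟩, fun w => ?_⟩
  have hT : ∀ u v, tangentForm g u v = B u.1 v.1 + B u.2 v.2 := fun u v =>
    congrArg₂ (· + ·) (hgB u.1 v.1) (hgB u.2 v.2)
  -- a `g̃`-orthogonal pair of nonzero vectors is linearly independent with Gram determinant the
  -- product of the squared lengths
  have key : ∀ u v : E × E, u ≠ 0 → v ≠ 0 → tangentForm g u v = 0 →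
      LinearIndependent ℝ (M := E × E)
        ![leftDeriv 𝓘(ℝ, E).tangent w u, leftDeriv 𝓘(ℝ, E).tangent w v] ∧
      ∃ d, 0 < d ∧ sectionalCurvature (tangentMetric g) w (leftDeriv 𝓘(ℝ, E).tangent w u)
        (leftDeriv 𝓘(ℝ, E).tangent w v) =
          tangentForm g (algCurvature (specialTangentProduct B ξ) u v v) u / d := by
    intro u v hu hv huv
    refine ⟨(linearIndependent_leftDeriv w u v).2 (LinearIndependent.pair_iff.2 fun s t hst => ?_),
      _, ?_, tangentMetric_sectionalCurvature hgB hbr w u v⟩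
    · have h1 := congrArg (tangentForm g u) hst
      have h2 := congrArg (tangentForm g v) hst
      simp only [map_add, map_smul, map_zero, smul_eq_mul, huv, tangentForm_symm g v u, mul_zero,
        add_zero, zero_add, mul_eq_zero, (tangentForm_pos g u hu).ne',
        (tangentForm_pos g v hv).ne', or_false] at h1 h2
      exact ⟨h1, h2⟩
    · rw [huv, zero_pow two_ne_zero, sub_zero]
      exact mul_pos (tangentForm_pos g u hu) (tangentForm_pos g v hv)
  have hN : 0 < B ξ ξ ^ 2 * B e e := mul_pos (pow_pos (hpos ξ hξ) 2) (hpos e he)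
  refine ⟨?_, ?_, ?_⟩
  · obtain ⟨hi, d, hd, h⟩ := key (0, ξ) (0, e) (by simpa using hξ) (by simpa using he)
      (by simp [hT, hξe])
    refine ⟨_, _, hi, ?_⟩
    rw [algCurvature_vertical hsymm hξe hT] at h
    exact (by positivity : (0 : ℝ) < _).trans_eq h.symm
  · obtain ⟨hi, d, hd, h⟩ := key (ξ, 0) (e, 0) (by simpa using hξ) (by simpa using he)
      (by simp [hT, hξe])
    refine ⟨_, _, hi, ?_⟩
    rw [algCurvature_horizontal hsymm hξe hT] at h
    exact h.trans_lt (div_neg_of_neg_of_pos (neg_neg_of_pos hN) hd)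
  · obtain ⟨hi, d, -, h⟩ := key (ξ, 0) (0, ξ) (by simpa using hξ) (by simpa using hξ)
      (by simp [hT])
    refine ⟨_, _, hi, ?_⟩
    rw [algCurvature_mixed hT, zero_div] at h
    exact h
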